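/- Let $\pi$ be a convex polygon with $2d+2$ vertices, where $d$ is an integer with $d>5$. An edge on $\pi$ is a set of two distinct vertices of $\pi$; two edges cross when they have four distinct endpoints that alternate along the boundary of $\pi$. A triangulation of $\pi$ is a maximal set of pairwise non-crossing edges on $\pi$. For a vertex $x$, let $\bar{x}$ denote the opposite vertex, i.e. the one separated from $x$ by exactly $d$ vertices along the boundary on either side. A triangulation $T$ is centrally symmetric if $\{\bar{x},\bar{y}\}\in T$ whenever $\{x,y\}\in T$. If $T$ is centrally symmetric, $\{x,x'\}\in T$ is not a boundary edge of $\pi$, and $x,y,x',y'$ is the quadrilateral whose four sides belong to $T$ and that admits $\{x,x'\}$ as a diagonal, then the flip of $\{x,x'\}$ in $T$ replaces the edges $\{x,x'\}$ and $\{\bar{x},\bar{x}'\}$ of $T$ by $\{y,y'\}$ and $\{\bar{y},\bar{y}'\}$. The distance of two centrally symmetric triangulations of $\pi$ is the least number of flips needed to transform one into the other through centrally symmetric triangulations, that is, their distance in the graph whose vertices are the centrally symmetric triangulations of $\pi$ and whose edges correspond to flips. Then there exists a pair of centrally symmetric triangulations of $\pi$ whose distance is at least $$\frac{5d}{2}-4\sqrt{d}-4.$$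 -/

import Mathlib

namespace Cyclohedron

/-- The vertices of a convex polygon with `2 * d + 2` vertices, labelled `0, …, 2 * d + 1`
in the order in which they are met along its boundary. -/
abbrev Vertex (d : ℕ) : Type := Fin (2 * d + 2)

/-- The vertex opposite `x`: the one separated from `x` by exactly `d` vertices along the
boundary, on either side. -/
def opp {d : ℕ} (x : Vertex d) : Vertex d :=
  ⟨(x.val + (d + 1)) % (2 * d + 2), Nat.mod_lt _ (by omega)⟩

/-- Two edges on a convex polygon (unordered pairs of vertices) cross when their four endpoints
are distinct and alternate along the boundary. -/
def Crosses {d : ℕ} (e f : Sym2 (Vertex d)) : Prop :=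
  ∃ p q r s : Vertex d, p < q ∧ q < r ∧ r < s ∧
    ((e = s(p, r) ∧ f = s(q, s)) ∨ (e = s(q, s) ∧ f = s(p, r)))

/-- A set of pairwise non-crossing edges; an edge has two distinct vertices. -/
def IsNonCrossing {d : ℕ} (S : Set (Sym2 (Vertex d))) : Prop :=
  (∀ e ∈ S, ¬ e.IsDiag) ∧ ∀ e ∈ S, ∀ f ∈ S, ¬ Crosses e f

/-- A triangulation is a maximal set of pairwise non-crossing edges. It contains the boundary
edges of the polygon. -/
def IsTriangulation {d : ℕ} (S : Set (Sym2 (Vertex d))) : Prop :=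
  Maximal IsNonCrossing S

/-- A centrally symmetric triangulation of a convex polygon with `2 * d + 2` vertices. -/
@[ext]
structure CSTriangulation (d : ℕ) where
  edges : Set (Sym2 (Vertex d))
  isTriangulation : IsTriangulation edges
  centrallySymmetric : ∀ x y : Vertex d, s(x, y) ∈ edges → s(opp x, opp y) ∈ edges

/-- `T'` is obtained from `T` by the flip of an interior edge `{x, x'}`: there is a quadrilateral
`x, y, x', y'` whose four sides belong to `T` and whose diagonals are `{x, x'}`, which belongs
to `T`, and `{y, y'}`. The flip replaces `{x, x'}` and the edge opposite to it by `{y, y'}` and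
the edge opposite to it. -/
def IsFlip {d : ℕ} (T T' : CSTriangulation d) : Prop :=
  ∃ x x' y y' : Vertex d,
    s(x, x') ∈ T.edges ∧ Crosses s(x, x') s(y, y') ∧
    s(x, y) ∈ T.edges ∧ s(y, x') ∈ T.edges ∧ s(x', y') ∈ T.edges ∧ s(y', x) ∈ T.edges ∧
    T'.edges = (T.edges \ {s(x, x'), s(opp x, opp x')}) ∪ {s(y, y'), s(opp y, opp y')}

/-- The flip graph: its vertices are the centrally symmetric triangulations, and two of them are
adjacent when one is obtained from the other by a flip. -/
def flipGraph (d : ℕ) : SimpleGraph (CSTriangulation d) :=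
  SimpleGraph.fromRel IsFlip

end Cyclohedron

/-! Label the vertices by integers modulo `2 * d + 2` and put `N = d + 1`, so that the central
symmetry is the translation by `N`. The triangles `(l, j, r)` with `r ≤ l + N` are taken up to this
translation.

The lower bound is a duality argument. Give every triangle an integer weight and let the potential
of a triangulation be the sum of its weights. Up to symmetry, a flip either exchanges two triangles
for two others inside a quadrilateral contained in a half of the polygon, or exchanges one triangle
on a diameter for one on another diameter. If neither exchange changes the potential by more than
`D` (`FlipBounded`), the distance is at least the difference of potentials divided by `D`
(`abs_potential_sub_le_dist`). As `SimpleGraph.dist` is zero between unreachable vertices, this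
needs the two triangulations to be connected (`reachable_ofTree`).

The weight depends on `k ≥ 1` and on a splitting `N = 2 * n + S` with `S ≥ 2 * k + 1`, and it
satisfies `FlipBounded` with `D = 2 * k` (`flipBounded_weight`). It is odd under the reflection `i ↦
n - i`. The two triangulations are mirror images under this reflection: `n` levels of a zigzag, then
a fan of `s = S - 1` triangles. A level of the first one weighs `2 - 5 * k`, and the total
potentials are `∓(n * (5 * k - 2) + (s - 2) * (k - 1))`. Hence the distance is at least `n * (5 - 2
/ k) + (s - 2) * (1 - 1 / k)`. Each level uses two of the `N` vertex classes, whence the main term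
`5 * d / 2`.

With `s` equal to `2 * k` or `2 * k + 1`, the loss is `3 * k + d / k` up to a bounded term. Taking
`k = ⌈√d / 2⌉` makes `3 * k + d / k` at most `4 * √d`. -/

namespace Cyclohedron

/-! ### Integer labels of the vertices, and crossings read on them -/

variable {d : ℕ}

/-- The vertex labelled by an integer, read modulo `2 * d + 2`. -/
def vtx (d : ℕ) (x : ℤ) : Vertex d :=
  ⟨(x % (2 * d + 2)).toNat, by
    have := Int.emod_lt_of_pos x (show (0 : ℤ) < 2 * d + 2 by omega)
    have := Int.emod_nonneg x (show (2 * (d : ℤ) + 2) ≠ 0 by omega)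
    omega⟩

theorem vtx_val (x : ℤ) : ((vtx d x).val : ℤ) = x % (2 * d + 2) := by
  have := Int.emod_nonneg x (show (2 * (d : ℤ) + 2) ≠ 0 by omega)
  simp only [vtx]; omega

theorem vtx_eq_iff {x y : ℤ} : vtx d x = vtx d y ↔ ∃ s : ℤ, y = x + s * (2 * d + 2) := by
  rw [Fin.ext_iff, ← Int.natCast_inj, vtx_val, vtx_val, Int.emod_eq_emod_iff_emod_sub_eq_zero,
    ← Int.dvd_iff_emod_eq_zero]
  constructor
  · rintro ⟨t, ht⟩
    exact ⟨-t, by linarith [mul_comm t (2 * (d : ℤ) + 2)]⟩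
  · rintro ⟨s, rfl⟩
    exact ⟨-s, by ring⟩

theorem vtx_add_mul (x s : ℤ) : vtx d (x + s * (2 * d + 2)) = vtx d x :=
  (vtx_eq_iff.2 ⟨s, rfl⟩).symm

theorem vtx_cast (p : Vertex d) : vtx d (p.val : ℤ) = p := by
  rw [Fin.ext_iff, ← Int.natCast_inj, vtx_val]
  have := p.isLt
  exact Int.emod_eq_of_lt (by omega) (by omega)

theorem exists_vtx_eq (p : Vertex d) (x : ℤ) : ∃ y, x ≤ y ∧ y < x + (2 * d + 2) ∧ vtx d y = p := by
  have hM : (0 : ℤ) < 2 * d + 2 := by omega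
  refine ⟨x + (p.val - x) % (2 * d + 2), ?_, ?_, ?_⟩
  · have := Int.emod_nonneg (p.val - x) hM.ne'; omega
  · have := Int.emod_lt_of_pos (p.val - x) hM; omega
  · conv_rhs => rw [← vtx_cast p]
    rw [vtx_eq_iff]
    exact ⟨(p.val - x) / (2 * d + 2), by linarith [Int.emod_add_mul_ediv (p.val - x) (2 * d + 2)]⟩

theorem opp_vtx (x : ℤ) : opp (vtx d x) = vtx d (x + (d + 1)) := by
  rw [Fin.ext_iff, ← Int.natCast_inj, vtx_val]
  simp only [opp]
  push_cast
  rw [vtx_val, Int.emod_add_emod]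

theorem vtx_eq_of_lt {x y z : ℤ} (hx : z ≤ x) (hx' : x < z + (2 * d + 2)) (hy : z ≤ y)
    (hy' : y < z + (2 * d + 2)) (h : vtx d x = vtx d y) : x = y := by
  obtain ⟨s, rfl⟩ := vtx_eq_iff.1 h
  have h1 : s < 1 := by by_contra! hs; nlinarith
  have h2 : -1 < s := by by_contra! hs; nlinarith
  obtain rfl : s = 0 := by omega
  simp

theorem crosses_symm {e f : Sym2 (Vertex d)} (h : Crosses e f) : Crosses f e := by
  obtain ⟨p, q, r, s, h1, h2, h3, h⟩ := h
  exact ⟨p, q, r, s, h1, h2, h3, h.symm.imp And.symm And.symm⟩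

/-- The cyclic order of four vertices can be read on any lift to the integers. -/
theorem exists_sorted_lift {x u y w : ℤ} (h1 : x < u) (h2 : u < y) (h3 : y < w)
    (h4 : w < x + (2 * d + 2)) : ∃ s : ℤ, ∃ a b c e : ℤ, 0 ≤ a ∧ a < b ∧ b < c ∧ c < e ∧
      e < 2 * d + 2 ∧ ∃ t : ℤ,
      ((a = x + s ∧ b = u + s ∧ c = y + s ∧ e = w + s ∧ s = t * (2 * d + 2)) ∨
      (a = w - (2 * d + 2) + s ∧ b = x + s ∧ c = u + s ∧ e = y + s ∧ s = t * (2 * d + 2)) ∨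
      (a = y - (2 * d + 2) + s ∧ b = w - (2 * d + 2) + s ∧ c = x + s ∧ e = u + s
        ∧ s = t * (2 * d + 2)) ∨
      (a = u - (2 * d + 2) + s ∧ b = y - (2 * d + 2) + s ∧ c = w - (2 * d + 2) + s ∧ e = x + s
        ∧ s = t * (2 * d + 2))) := by
  have hM : (0 : ℤ) < 2 * d + 2 := by omega
  have e1 := Int.emod_nonneg x hM.ne'
  have e2 := Int.emod_lt_of_pos x hM
  have e3 := Int.emod_add_mul_ediv x (2 * d + 2)
  obtain ⟨s, hs⟩ : ∃ s, s = -(x / (2 * (d : ℤ) + 2)) * (2 * d + 2) := ⟨_, rfl⟩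
  have hxs : x + s = x % (2 * d + 2) := by rw [hs]; linarith
  refine ⟨s, ?_⟩
  by_cases c1 : w + s < 2 * d + 2
  · exact ⟨x + s, u + s, y + s, w + s, by omega, by omega, by omega, by omega, by omega, _,
      Or.inl ⟨rfl, rfl, rfl, rfl, hs⟩⟩
  by_cases c2 : y + s < 2 * d + 2
  · exact ⟨_, _, _, _, by omega, by omega, by omega, by omega, by omega, _,
      Or.inr (Or.inl ⟨rfl, rfl, rfl, rfl, hs⟩)⟩
  by_cases c3 : u + s < 2 * d + 2
  · exact ⟨_, _, _, _, by omega, by omega, by omega, by omega, by omega, _,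
      Or.inr (Or.inr (Or.inl ⟨rfl, rfl, rfl, rfl, hs⟩))⟩
  · exact ⟨_, _, _, _, by omega, by omega, by omega, by omega, by omega, _,
      Or.inr (Or.inr (Or.inr ⟨rfl, rfl, rfl, rfl, hs⟩))⟩

theorem vtx_lt_vtx {a b : ℤ} (ha : 0 ≤ a) (hab : a < b) (hb : b < 2 * d + 2) :
    vtx d a < vtx d b := by
  have h1 := vtx_val (d := d) a
  have h2 := vtx_val (d := d) b
  rw [Int.emod_eq_of_lt (by omega) (by omega)] at h1 h2
  rw [Fin.lt_def]; omega

theorem vtx_sub (x : ℤ) : vtx d (x - (2 * d + 2)) = vtx d x := by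
  rw [← vtx_add_mul (d := d) x (-1)]; congr 1; ring

theorem crosses_of_lt {x u y w : ℤ} (h1 : x < u) (h2 : u < y) (h3 : y < w)
    (h4 : w < x + (2 * d + 2)) : Crosses s(vtx d x, vtx d y) s(vtx d u, vtx d w) := by
  obtain ⟨s, a, b, c, e, k1, k2, k3, k4, k5, t, h⟩ := exists_sorted_lift h1 h2 h3 h4
  refine ⟨vtx d a, vtx d b, vtx d c, vtx d e, vtx_lt_vtx k1 k2 (by omega),
    vtx_lt_vtx (by omega) k3 (by omega), vtx_lt_vtx (by omega) k4 (by omega), ?_⟩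
  rcases h with ⟨rfl, rfl, rfl, rfl, rfl⟩ | ⟨rfl, rfl, rfl, rfl, rfl⟩ | ⟨rfl, rfl, rfl, rfl, rfl⟩ |
    ⟨rfl, rfl, rfl, rfl, rfl⟩ <;> rw [vtx_add_mul, vtx_add_mul, vtx_add_mul, vtx_add_mul] <;>
    simp only [vtx_sub]
  · exact Or.inl ⟨trivial, trivial⟩
  · exact Or.inr ⟨trivial, Sym2.eq_swap⟩
  · exact Or.inl ⟨Sym2.eq_swap, Sym2.eq_swap⟩
  · exact Or.inr ⟨Sym2.eq_swap, trivial⟩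

theorem exists_lift_of_crosses {p q r s : Vertex d} (h : Crosses s(p, r) s(q, s)) :
    ∃ x u y w : ℤ, x < u ∧ u < y ∧ y < w ∧ w < x + (2 * d + 2) ∧ vtx d x = p ∧ vtx d y = r ∧
      ((vtx d u = q ∧ vtx d w = s) ∨ (vtx d u = s ∧ vtx d w = q)) := by
  have key : ∀ a b c e : Vertex d, a < b → b < c → c < e → ∃ x u y w : ℤ, x < u ∧ u < y ∧ y < w ∧
      w < x + (2 * d + 2) ∧ vtx d x = a ∧ vtx d u = b ∧ vtx d y = c ∧ vtx d w = e := by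
    intro a b c e h1 h2 h3
    rw [Fin.lt_def] at h1 h2 h3
    have := e.isLt
    exact ⟨a.val, b.val, c.val, e.val, by omega, by omega, by omega, by omega, vtx_cast _,
      vtx_cast _, vtx_cast _, vtx_cast _⟩
  have rot : ∀ (x : ℤ), vtx d (x + (2 * d + 2)) = vtx d x := fun x ↦ by
    simpa using vtx_add_mul (d := d) x 1
  obtain ⟨a, b, c, e, h1, h2, h3, h⟩ := h
  obtain ⟨x, u, y, w, k1, k2, k3, k4, rfl, rfl, rfl, rfl⟩ := key a b c e h1 h2 h3
  simp only [Sym2.eq_iff] at h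
  rcases h with ⟨⟨rfl, rfl⟩ | ⟨rfl, rfl⟩, h'⟩ | ⟨⟨rfl, rfl⟩ | ⟨rfl, rfl⟩, h'⟩
  · refine ⟨x, u, y, w, k1, k2, k3, k4, rfl, rfl, ?_⟩
    rcases h' with ⟨h, h'⟩ | ⟨h, h'⟩ <;> simp [h, h']
  · refine ⟨y, w, x + (2 * d + 2), u + (2 * d + 2), k3, by omega, by omega, by omega, rfl,
      rot _, ?_⟩
    rw [rot]
    rcases h' with ⟨h, h'⟩ | ⟨h, h'⟩ <;> simp [h, h']
  · refine ⟨u, y, w, x + (2 * d + 2), k2, k3, by omega, by omega, rfl, rfl, ?_⟩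
    rw [rot]
    rcases h' with ⟨h, h'⟩ | ⟨h, h'⟩ <;> simp [h, h']
  · refine ⟨w, x + (2 * d + 2), u + (2 * d + 2), y + (2 * d + 2), by omega, by omega, by omega,
      by omega, rfl, rot _, ?_⟩
    rw [rot, rot]
    rcases h' with ⟨h, h'⟩ | ⟨h, h'⟩ <;> simp [h, h']

/-! ### Triangulations of a polygon with a distinguished side, as binary trees -/

/-- Binary trees, encoding triangulations of a polygon with a distinguished side. -/
inductive Tree : Type
  | leaf : Tree
  | node : Tree → Tree → Tree

namespace Tree

/-- The number of leaves, as an integer. -/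
def size : Tree → ℤ
  | leaf => 1
  | node l r => l.size + r.size

/-- `t.Arc i x y` says that `(x, y)` is a side of the triangulation encoded by `t` of the polygon
with vertices `i, …, i + t.size`. -/
def Arc : Tree → ℤ → ℤ → ℤ → Prop
  | leaf, i, x, y => x = i ∧ y = i + 1
  | node l r, i, x, y =>
    (x = i ∧ y = i + (l.size + r.size)) ∨ l.Arc i x y ∨ r.Arc (i + l.size) x y

theorem size_pos : ∀ t : Tree, 1 ≤ t.size
  | leaf => le_rfl
  | node l r => by have := l.size_pos; have := r.size_pos; simp only [size]; omega

theorem Arc.bounds : ∀ {t : Tree} {i x y : ℤ}, t.Arc i x y → i ≤ x ∧ x < y ∧ y ≤ i + t.size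
  | leaf, i, x, y, h => by simp only [Arc, size] at *; omega
  | node l r, i, x, y, h => by
    have h1 := l.size_pos; have h2 := r.size_pos; simp only [size]
    rcases h with h | h | h
    · omega
    · have := h.bounds; omega
    · have := h.bounds; omega

theorem arc_root : ∀ (t : Tree) (i : ℤ), t.Arc i i (i + t.size)
  | leaf, _ => ⟨rfl, rfl⟩
  | node _ _, _ => Or.inl ⟨rfl, rfl⟩

theorem arc_root' (t : Tree) {i j : ℤ} (h : j = i + t.size) : t.Arc i i j := h ▸ t.arc_root i

theorem Arc.not_cross : ∀ {t : Tree} {i x y u w : ℤ}, t.Arc i x y → t.Arc i u w →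
    x < u → u < y → y < w → False
  | leaf, i, x, y, u, w, h, h', h1, h2, h3 => by simp only [Arc] at *; omega
  | node l r, i, x, y, u, w, h, h', h1, h2, h3 => by
    have e := h'.bounds
    have e' := h.bounds
    simp only [size] at e e'
    rcases h with h | h | h <;> rcases h' with h' | h' | h'
    any_goals omega
    · exact h.not_cross h' h1 h2 h3
    · have := h.bounds; have := h'.bounds; omega
    · have := h.bounds; have := h'.bounds; omega
    · exact h.not_cross h' h1 h2 h3

/-- This is the maximality of the encoded triangulation. A missing pair that straddles the apex of
the root triangle is crossed by the right child's root side if it starts at `i`, and by the left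
child's otherwise. -/
theorem exists_arc_cross : ∀ {t : Tree} {i p q : ℤ}, i ≤ p → p < q → q ≤ i + t.size →
    ¬ t.Arc i p q → ∃ x y, t.Arc i x y ∧ ((x < p ∧ p < y ∧ y < q) ∨ (p < x ∧ x < q ∧ q < y))
  | leaf, i, p, q, h1, h2, h3, h => by simp only [Arc, size] at *; omega
  | node l r, i, p, q, h1, h2, h3, h => by
    have e1 := l.size_pos; have e2 := r.size_pos
    simp only [size] at h3
    by_cases c1 : q ≤ i + l.size
    · obtain ⟨x, y, h, h'⟩ := exists_arc_cross h1 h2 c1 fun h' ↦ h (Or.inr (Or.inl h'))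
      exact ⟨x, y, Or.inr (Or.inl h), h'⟩
    by_cases c2 : i + l.size ≤ p
    · obtain ⟨x, y, h, h'⟩ := exists_arc_cross (t := r) c2 h2 (by omega)
        fun h' ↦ h (Or.inr (Or.inr h'))
      exact ⟨x, y, Or.inr (Or.inr h), h'⟩
    by_cases c3 : p = i
    · have : q ≠ i + (l.size + r.size) := fun h' ↦ h (Or.inl ⟨c3, h'⟩)
      exact ⟨_, _, Or.inr (Or.inr (r.arc_root _)), Or.inr ⟨by omega, by omega, by omega⟩⟩
    · exact ⟨_, _, Or.inr (Or.inl (l.arc_root _)), Or.inl ⟨by omega, by omega, by omega⟩⟩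

theorem arc_add_iff : ∀ {t : Tree} {i x y s : ℤ}, t.Arc (i + s) (x + s) (y + s) ↔ t.Arc i x y
  | leaf, i, x, y, s => by simp only [Arc]; omega
  | node l r, i, x, y, s => by
    simp only [Arc]
    rw [arc_add_iff (t := l), show i + s + l.size = i + l.size + s by ring, arc_add_iff (t := r)]
    refine or_congr (by omega) Iff.rfl

end Tree

/-! ### Centrally symmetric triangulations built from a tree -/

/-- The edges of the polygon obtained from a set of pairs of integers by closing it under the
central symmetry. -/
def chords (d : ℕ) (P : ℤ → ℤ → Prop) : Set (Sym2 (Vertex d)) :=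
  {e | ∃ x y s : ℤ, P x y ∧ e = s(vtx d (x + s * (d + 1)), vtx d (y + s * (d + 1)))}

theorem opp_mem_chords {P : ℤ → ℤ → Prop} {x y : Vertex d} (h : s(x, y) ∈ chords d P) :
    s(opp x, opp y) ∈ chords d P := by
  obtain ⟨a, b, s, hP, h⟩ := h
  refine ⟨a, b, s + 1, hP, ?_⟩
  have e : ∀ a : ℤ, a + (s + 1) * (d + 1) = a + s * (d + 1) + (d + 1) := fun a ↦ by ring
  rw [e, e, ← opp_vtx, ← opp_vtx]
  rcases Sym2.eq_iff.1 h with ⟨rfl, rfl⟩ | ⟨rfl, rfl⟩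
  · rfl
  · exact Sym2.eq_swap

/-- An edge shorter than a diameter has only one lift of length at most `d + 1`, up to full turns. A
diameter has two, one for each direction, and they differ by a half turn. -/
theorem eq_of_vtx_pair_eq {x y u w : ℤ} (h1 : x < y) (h2 : y ≤ x + (d + 1)) (h3 : u < w)
    (h4 : w ≤ u + (d + 1)) (h : s(vtx d x, vtx d y) = s(vtx d u, vtx d w)) :
    ∃ s : ℤ, x = u + s * (d + 1) ∧ y = w + s * (d + 1) := by
  rcases Sym2.eq_iff.1 h with ⟨h, h'⟩ | ⟨h, h'⟩
  · obtain ⟨s, rfl⟩ := vtx_eq_iff.1 h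
    obtain ⟨t, rfl⟩ := vtx_eq_iff.1 h'
    have k1 : s - t < 1 := by by_contra!; nlinarith
    have k2 : -1 < s - t := by by_contra!; nlinarith
    obtain rfl : s = t := by omega
    exact ⟨-2 * s, by ring, by ring⟩
  · obtain ⟨s, rfl⟩ := vtx_eq_iff.1 h
    obtain ⟨t, rfl⟩ := vtx_eq_iff.1 h'
    have k1 : s - t < 2 := by by_contra!; nlinarith
    have k2 : 0 < s - t := by by_contra!; nlinarith
    obtain rfl : s = t + 1 := by omega
    have : x = y - (d + 1) := by nlinarith
    subst this
    exact ⟨-2 * t - 1, by ring, by ring⟩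

theorem exists_mul_le (c x : ℤ) : ∃ s : ℤ, c ≤ x + s * (d + 1) ∧ x + s * (d + 1) < c + (d + 1) := by
  have hN : (0 : ℤ) < d + 1 := by omega
  have e1 := Int.emod_nonneg (x - c) hN.ne'
  have e2 := Int.emod_lt_of_pos (x - c) hN
  have e3 := Int.emod_add_mul_ediv (x - c) (d + 1)
  exact ⟨-((x - c) / (d + 1)), by nlinarith, by nlinarith⟩

theorem mem_chords_iff {P : ℤ → ℤ → Prop} (hP : ∀ x y, P x y → x < y ∧ y ≤ x + (d + 1)) {x y : ℤ}
    (h1 : x < y) (h2 : y ≤ x + (d + 1)) :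
    s(vtx d x, vtx d y) ∈ chords d P ↔ ∃ s : ℤ, P (x + s * (d + 1)) (y + s * (d + 1)) := by
  constructor
  · rintro ⟨a, b, s, hab, h⟩
    have := hP _ _ hab
    obtain ⟨t, rfl, rfl⟩ := eq_of_vtx_pair_eq h1 h2 (by omega) (by omega) h
    refine ⟨-t - s, ?_⟩
    convert hab using 1 <;> ring
  · rintro ⟨s, h⟩
    exact ⟨_, _, -s, h, by congr 3 <;> ring⟩

theorem mem_chords_of {P : ℤ → ℤ → Prop} {x y : ℤ} (h : P x y) :
    s(vtx d x, vtx d y) ∈ chords d P :=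
  ⟨x, y, 0, h, by simp⟩

/-- Both translated arcs lie in a window of length `d + 1`. Their strict overlap forces the two
translations to agree, and a tree has no crossing arcs. -/
theorem not_cross_translate {t : Tree} (ht : t.size = d + 1) {c x y u w s s' : ℤ}
    (hx : t.Arc c (x + s * (d + 1)) (y + s * (d + 1)))
    (hu : t.Arc c (u + s' * (d + 1)) (w + s' * (d + 1)))
    (h1 : x < u) (h2 : u < y) (h3 : y < w) : False := by
  have b1 := hx.bounds
  have b2 := hu.bounds
  rw [ht] at b1 b2
  have k1 : s' - s < 1 := by by_contra!; nlinarith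
  have k2 : -1 < s' - s := by by_contra!; nlinarith
  obtain rfl : s = s' := by omega
  exact hx.not_cross hu (by omega) (by omega) (by omega)

theorem exists_arc_of_mem {t : Tree} (ht : t.size = d + 1) {c x y : ℤ} (h1 : x < y)
    (h2 : y < x + (2 * d + 2)) (h : s(vtx d x, vtx d y) ∈ chords d (t.Arc c)) :
    ∃ s : ℤ, t.Arc c (x + s * (d + 1)) (y + s * (d + 1)) ∨
      t.Arc c (y + s * (d + 1)) (x + (2 * d + 2) + s * (d + 1)) := by
  have hP : ∀ x y, t.Arc c x y → x < y ∧ y ≤ x + (d + 1) := fun x y h ↦ by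
    have := h.bounds; omega
  by_cases hc : y ≤ x + (d + 1)
  · obtain ⟨s, hs⟩ := (mem_chords_iff hP h1 hc).1 h
    exact ⟨s, Or.inl hs⟩
  · have : vtx d x = vtx d (x + (2 * d + 2)) := by simpa using (vtx_add_mul (d := d) x 1).symm
    rw [this, Sym2.eq_swap] at h
    obtain ⟨s, hs⟩ := (mem_chords_iff hP (by omega) (by omega)).1 h
    exact ⟨s, Or.inr hs⟩

theorem isNonCrossing_chords {t : Tree} (ht : t.size = d + 1) (c : ℤ) :
    IsNonCrossing (chords d (t.Arc c)) := by
  constructor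
  · rintro e ⟨x, y, s, h, rfl⟩ hd
    have := h.bounds
    have := vtx_eq_of_lt (z := x + s * (d + 1)) le_rfl (by omega) (by omega) (by omega)
      (Sym2.mk_isDiag_iff.1 hd)
    omega
  · rintro e he f hf hef
    induction e using Sym2.ind with | _ p r
    induction f using Sym2.ind with | _ q s
    obtain ⟨x, u, y, w, h1, h2, h3, h4, rfl, rfl, h⟩ := exists_lift_of_crosses hef
    have hf' : s(vtx d u, vtx d w) ∈ chords d (t.Arc c) := by
      rcases h with ⟨rfl, rfl⟩ | ⟨rfl, rfl⟩
      · exact hf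
      · rwa [Sym2.eq_swap]
    have e1 : ∀ a s : ℤ, a + (2 * d + 2) + s * (d + 1) = a + (s + 2) * (d + 1) := fun a s ↦ by ring
    have e2 : ∀ a s : ℤ, a + s * (d + 1) = a - (2 * d + 2) + (s + 2) * (d + 1) := fun a s ↦ by ring
    -- Each of the two edges is an arc of the window on one of its two sides, which gives four
    -- cases. In each, a cyclic rotation of the four endpoints yields a linear crossing of two arcs.
    obtain ⟨s, hs | hs⟩ := exists_arc_of_mem ht (by omega) (by omega) he <;>
    obtain ⟨s', hs' | hs'⟩ := exists_arc_of_mem ht (by omega) (by omega) hf'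
    · exact not_cross_translate ht hs hs' h1 h2 h3
    · rw [e1, e2 w] at hs'
      exact not_cross_translate ht hs' hs (by omega) h1 h2
    · exact not_cross_translate ht hs' hs h2 h3 h4
    · exact not_cross_translate ht hs hs' h3 h4 (by omega)

theorem exists_cross_chords {t : Tree} (ht : t.size = d + 1) (c : ℤ) {x y : ℤ} (h1 : x < y)
    (h2 : y ≤ x + (d + 1)) (h : s(vtx d x, vtx d y) ∉ chords d (t.Arc c)) :
    ∃ f ∈ chords d (t.Arc c), Crosses s(vtx d x, vtx d y) f := by
  have hP : ∀ x y, t.Arc c x y → x < y ∧ y ≤ x + (d + 1) := fun x y h ↦ by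
    have := h.bounds; omega
  rw [mem_chords_iff hP h1 h2] at h
  push Not at h
  obtain ⟨s, k1, k2⟩ := exists_mul_le (d := d) c x
  have key : ∀ u w : ℤ, t.Arc c u w → ((u < x + s * (d + 1) ∧ x + s * (d + 1) < w ∧
      w < y + s * (d + 1)) ∨ (x + s * (d + 1) < u ∧ u < y + s * (d + 1) ∧ y + s * (d + 1) < w)) →
      ∃ f ∈ chords d (t.Arc c), Crosses s(vtx d x, vtx d y) f := by
    intro u w hA hc
    have := hA.bounds
    refine ⟨s(vtx d (u + -s * (d + 1)), vtx d (w + -s * (d + 1))), ⟨u, w, -s, hA, rfl⟩, ?_⟩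
    have e : ∀ a : ℤ, a + -s * (d + 1) = a - s * (d + 1) := fun a ↦ by ring
    rw [e, e]
    rcases hc with hc | hc
    · exact crosses_symm (crosses_of_lt (by omega) (by omega) (by omega) (by omega))
    · exact crosses_of_lt (by omega) (by omega) (by omega) (by omega)
  by_cases hc : y + s * (d + 1) ≤ c + (d + 1)
  · obtain ⟨u, w, hA, hx⟩ := Tree.exists_arc_cross (t := t) k1 (by omega) (by omega) (h s)
    exact key u w hA hx
  -- The pair leaves the window containing its left end, so the diameter at `c` crosses it.
  · refine key c (c + t.size) (t.arc_root c) (Or.inl ?_)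
    omega

theorem isTriangulation_chords {t : Tree} (ht : t.size = d + 1) (c : ℤ) :
    IsTriangulation (chords d (t.Arc c)) := by
  refine ⟨isNonCrossing_chords ht c, fun S hS hle e he ↦ ?_⟩
  by_contra hne
  induction e using Sym2.ind with | _ p q
  have hpq : p ≠ q := fun h ↦ hS.1 _ he (Sym2.mk_isDiag_iff.2 h)
  obtain ⟨x, rfl⟩ : ∃ x : ℤ, vtx d x = p := ⟨_, vtx_cast p⟩
  obtain ⟨y, h1, h2, rfl⟩ := exists_vtx_eq q x
  have hxy : x ≠ y := fun h ↦ hpq (by rw [h])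
  by_cases hc : y ≤ x + (d + 1)
  · obtain ⟨f, hf, hx⟩ := exists_cross_chords ht c (by omega) hc hne
    exact hS.2 _ he f (hle hf) hx
  · have : vtx d x = vtx d (x + (2 * d + 2)) := by simpa using (vtx_add_mul (d := d) x 1).symm
    rw [this, Sym2.eq_swap] at hne he
    obtain ⟨f, hf, hx⟩ := exists_cross_chords ht c (by omega) (by omega) hne
    exact hS.2 _ he f (hle hf) hx

/-- The centrally symmetric triangulation with the diameter from `c` to its opposite, and one of
the two sides of which is triangulated according to `t`. -/
def CSTriangulation.ofTree (c : ℤ) (t : Tree) (ht : t.size = d + 1) : CSTriangulation d where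
  edges := chords d (t.Arc c)
  isTriangulation := isTriangulation_chords ht c
  centrallySymmetric _ _ h := opp_mem_chords h

theorem chords_or (P Q : ℤ → ℤ → Prop) :
    chords d (fun x y ↦ P x y ∨ Q x y) = chords d P ∪ chords d Q := by
  ext e
  constructor
  · rintro ⟨x, y, s, h | h, rfl⟩
    · exact Or.inl ⟨x, y, s, h, rfl⟩
    · exact Or.inr ⟨x, y, s, h, rfl⟩
  · rintro (⟨x, y, s, h, rfl⟩ | ⟨x, y, s, h, rfl⟩)
    · exact ⟨x, y, s, Or.inl h, rfl⟩
    · exact ⟨x, y, s, Or.inr h, rfl⟩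

theorem chords_add (P : ℤ → ℤ → Prop) :
    chords d (fun x y ↦ P (x - (d + 1)) (y - (d + 1))) = chords d P := by
  ext e
  constructor
  · rintro ⟨x, y, s, h, rfl⟩
    exact ⟨_, _, s + 1, h, by congr 2 <;> ring_nf⟩
  · rintro ⟨x, y, s, h, rfl⟩
    exact ⟨x + (d + 1), y + (d + 1), s - 1, by simpa using h, by congr 2 <;> ring_nf⟩

theorem chords_single (x y : ℤ) : chords d (fun u w ↦ u = x ∧ w = y) =
    {s(vtx d x, vtx d y), s(opp (vtx d x), opp (vtx d y))} := by
  ext e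
  rw [opp_vtx, opp_vtx]
  constructor
  · rintro ⟨u, w, s, ⟨rfl, rfl⟩, rfl⟩
    rcases Int.even_or_odd' s with ⟨t, rfl | rfl⟩
    · left
      have e (a : ℤ) : vtx d (a + 2 * t * (d + 1)) = vtx d a := by
        rw [← vtx_add_mul a t]; congr 1; ring
      rw [e, e]
    · right
      have e (a : ℤ) : vtx d (a + (2 * t + 1) * (d + 1)) = vtx d (a + (d + 1)) := by
        rw [← vtx_add_mul (a + (d + 1)) t]; congr 1; ring
      rw [e, e]; rfl
  · rintro (rfl | rfl)
    · exact ⟨x, y, 0, ⟨rfl, rfl⟩, by simp⟩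
    · exact ⟨x, y, 1, ⟨rfl, rfl⟩, by simp⟩

/-- The pairs in a window of length `d + 1` are determined by their chords. -/
theorem chords_diff {P : ℤ → ℤ → Prop} {c x y : ℤ}
    (hP : ∀ x y, P x y → c ≤ x ∧ x < y ∧ y ≤ c + (d + 1)) (hxy : P x y) :
    chords d (fun u w ↦ P u w ∧ ¬ (u = x ∧ w = y)) =
      chords d P \ {s(vtx d x, vtx d y), s(opp (vtx d x), opp (vtx d y))} := by
  rw [← chords_single]
  ext e
  constructor
  · rintro ⟨u, w, s, ⟨h, hne⟩, rfl⟩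
    refine ⟨⟨u, w, s, h, rfl⟩, ?_⟩
    rintro ⟨x', y', t, ⟨h1, h2⟩, he⟩
    subst h1 h2
    have := hP _ _ h
    have := hP _ _ hxy
    obtain ⟨r, h1, h2⟩ := eq_of_vtx_pair_eq (by omega) (by omega) (by omega) (by omega) he
    have e1 : u = x' + (t + r - s) * (d + 1) := by linarith
    have e2 : w = y' + (t + r - s) * (d + 1) := by linarith
    have k1 : (t + r - s) < 1 := by by_contra!; nlinarith
    have k2 : -1 < (t + r - s) := by by_contra!; nlinarith
    have k3 : t + r - s = 0 := by omega
    rw [k3] at e1 e2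
    exact hne ⟨by simpa using e1, by simpa using e2⟩
  · rintro ⟨⟨u, w, s, h, rfl⟩, hne⟩
    refine ⟨u, w, s, ⟨h, ?_⟩, rfl⟩
    rintro ⟨rfl, rfl⟩
    exact hne ⟨u, w, s, ⟨rfl, rfl⟩, rfl⟩

/-! ### Rotations, central flips and connectedness -/

namespace Tree

/-- Tree rotations at any place of a tree. -/
inductive Rot : Tree → Tree → Prop
  | assoc (a b c : Tree) : Rot (node (node a b) c) (node a (node b c))
  | left {l l' : Tree} (r : Tree) : Rot l l' → Rot (node l r) (node l' r)
  | right (l : Tree) {r r' : Tree} : Rot r r' → Rot (node l r) (node l r')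

theorem Rot.size_eq {t t' : Tree} (h : Rot t t') : t.size = t'.size := by
  induction h <;> simp only [size] <;> omega

theorem Rot.arcs {t t' : Tree} (h : Rot t t') : ∀ i : ℤ, ∃ x y x' y' : ℤ, x < y ∧ y < x' ∧ x' < y' ∧
    t.Arc i x x' ∧ t.Arc i x y ∧ t.Arc i y x' ∧ t.Arc i x' y' ∧ t.Arc i x y' ∧
    ∀ u w, t'.Arc i u w ↔ (t.Arc i u w ∧ ¬ (u = x ∧ w = x')) ∨ (u = y ∧ w = y') := by
  induction h with
  | assoc a b c =>
    intro i
    have h1 := a.size_pos; have h2 := b.size_pos; have h3 := c.size_pos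
    refine ⟨i, i + a.size, i + a.size + b.size, i + a.size + b.size + c.size, by omega, by omega,
      by omega, ?_, ?_, ?_, ?_, ?_, fun u w ↦ ?_⟩
    · exact Or.inr (Or.inl (arc_root' _ (by simp only [size]; omega)))
    · exact Or.inr (Or.inl (Or.inr (Or.inl (arc_root _ _))))
    · exact Or.inr (Or.inl (Or.inr (Or.inr (arc_root _ _))))
    · refine Or.inr (Or.inr ?_)
      rw [show i + (a.node b).size = i + a.size + b.size by simp only [size]; omega]
      exact arc_root _ _
    · exact arc_root' _ (by simp only [size]; omega)
    · have k1 : a.Arc i u w → _ := Arc.bounds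
      have k2 : b.Arc (i + a.size) u w → _ := Arc.bounds
      have k3 : c.Arc (i + a.size + b.size) u w → _ := Arc.bounds
      simp only [Arc, size, ← add_assoc]
      constructor
      · rintro (h | h | h | h | h)
        · exact Or.inl ⟨Or.inl h, by omega⟩
        · exact Or.inl ⟨Or.inr (Or.inl (Or.inr (Or.inl h))), by have := k1 h; omega⟩
        · exact Or.inr (by omega)
        · exact Or.inl ⟨Or.inr (Or.inl (Or.inr (Or.inr h))), by have := k2 h; omega⟩
        · exact Or.inl ⟨Or.inr (Or.inr h), by have := k3 h; omega⟩
      · rintro (⟨h | (h | h | h) | h, h'⟩ | h)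
        · exact Or.inl h
        · omega
        · exact Or.inr (Or.inl h)
        · exact Or.inr (Or.inr (Or.inr (Or.inl h)))
        · exact Or.inr (Or.inr (Or.inr (Or.inr h)))
        · exact Or.inr (Or.inr (Or.inl (by omega)))
  | @left l l' r hl ih =>
    intro i
    obtain ⟨x, y, x', y', h1, h2, h3, a1, a2, a3, a4, a5, h⟩ := ih i
    refine ⟨x, y, x', y', h1, h2, h3, Or.inr (Or.inl a1), Or.inr (Or.inl a2), Or.inr (Or.inl a3),
      Or.inr (Or.inl a4), Or.inr (Or.inl a5), fun u w ↦ ?_⟩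
    have e1 := r.size_pos
    have b1 := a5.bounds
    have e2 := hl.size_eq
    have k : r.Arc (i + l.size) u w → _ := Arc.bounds
    simp only [Arc, h, ← e2]
    constructor
    · rintro (h | (h | h) | h)
      · exact Or.inl ⟨Or.inl h, by omega⟩
      · exact Or.inl ⟨Or.inr (Or.inl h.1), h.2⟩
      · exact Or.inr h
      · exact Or.inl ⟨Or.inr (Or.inr h), by have := k h; omega⟩
    · rintro (⟨h | h | h, h'⟩ | h)
      · exact Or.inl h
      · exact Or.inr (Or.inl (Or.inl ⟨h, h'⟩))
      · exact Or.inr (Or.inr h)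
      · exact Or.inr (Or.inl (Or.inr h))
  | @right l r r' hl ih =>
    intro i
    obtain ⟨x, y, x', y', h1, h2, h3, a1, a2, a3, a4, a5, h⟩ := ih (i + l.size)
    refine ⟨x, y, x', y', h1, h2, h3, Or.inr (Or.inr a1), Or.inr (Or.inr a2), Or.inr (Or.inr a3),
      Or.inr (Or.inr a4), Or.inr (Or.inr a5), fun u w ↦ ?_⟩
    have e1 := l.size_pos
    have b1 := a5.bounds
    have e2 := hl.size_eq
    have k : l.Arc i u w → _ := Arc.bounds
    simp only [Arc, h, ← e2]
    constructor
    · rintro (h | h | h | h)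
      · exact Or.inl ⟨Or.inl h, by omega⟩
      · exact Or.inl ⟨Or.inr (Or.inl h), by have := k h; omega⟩
      · exact Or.inl ⟨Or.inr (Or.inr h.1), h.2⟩
      · exact Or.inr h
    · rintro (⟨h | h | h, h'⟩ | h)
      · exact Or.inl h
      · exact Or.inr (Or.inl h)
      · exact Or.inr (Or.inr (Or.inl ⟨h, h'⟩))
      · exact Or.inr (Or.inr (Or.inr h))

/-- The tree all of whose left children are leaves. -/
def comb : ℕ → Tree
  | 0 => leaf
  | n + 1 => node leaf (comb n)

theorem comb_size (n : ℕ) : (comb n).size = n + 1 := by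
  induction n with
  | zero => rfl
  | succ n ih => simp only [comb, size, ih]; push_cast; ring

theorem comb_node (a b : ℕ) :
    Relation.ReflTransGen Rot (node (comb a) (comb b)) (comb (a + b + 1)) := by
  induction a with
  | zero => rw [zero_add]; exact .refl
  | succ a ih =>
    refine .head (.assoc _ _ _) ?_
    rw [show a + 1 + b + 1 = a + b + 1 + 1 by ring]
    exact ih.lift (node leaf) fun _ _ h ↦ .right _ h

/-- Right rotations bring every tree to the comb with as many leaves, so combs serve as hubs of the
flip graph. -/
theorem exists_rot_comb (t : Tree) : ∃ n, Relation.ReflTransGen Rot t (comb n) := by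
  induction t with
  | leaf => exact ⟨0, .refl⟩
  | node l r hl hr =>
    obtain ⟨a, ha⟩ := hl
    obtain ⟨b, hb⟩ := hr
    exact ⟨_, ((ha.lift (fun l ↦ node l r) fun _ _ h ↦ .left _ h).trans
      (hb.lift (node _) fun _ _ h ↦ .right _ h)).trans (comb_node a b)⟩

end Tree

namespace CSTriangulation

theorem reachable_of_isFlip {T T' : CSTriangulation d} (h : IsFlip T T') :
    (flipGraph d).Reachable T T' := by
  by_cases hne : T = T'
  · rw [hne]
  · exact SimpleGraph.Adj.reachable ((SimpleGraph.fromRel_adj _ _ _).2 ⟨hne, Or.inl h⟩)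

theorem reachable_rot {t t' : Tree} (h : Tree.Rot t t') (c : ℤ) (ht : t.size = d + 1)
    (ht' : t'.size = d + 1) : (flipGraph d).Reachable (ofTree c t ht) (ofTree c t' ht') := by
  obtain ⟨x, y, x', y', h1, h2, h3, a1, a2, a3, a4, a5, h⟩ := h.arcs c
  have := a5.bounds
  refine reachable_of_isFlip ⟨vtx d x, vtx d x', vtx d y, vtx d y', mem_chords_of a1,
    crosses_of_lt h1 h2 h3 (by omega), mem_chords_of a2, mem_chords_of a3, mem_chords_of a4, ?_, ?_⟩
  · rw [Sym2.eq_swap]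
    exact mem_chords_of a5
  · simp only [ofTree]
    rw [← chords_single y y', ← chords_diff (c := c) _ a1, ← chords_or]
    · congr 1; ext u w; exact h u w
    · intro u w hA
      have := hA.bounds
      omega

theorem reachable_reflTransGen {t t' : Tree} (h : Relation.ReflTransGen Tree.Rot t t') (c : ℤ)
    (ht : t.size = d + 1) (ht' : t'.size = d + 1) :
    (flipGraph d).Reachable (ofTree c t ht) (ofTree c t' ht') := by
  induction h with
  | refl => rfl
  | tail h1 h2 ih => exact (ih (h2.size_eq.trans ht')).trans (reachable_rot h2 c _ _)

/-- The flip of the diameter at `c` moves it to the apex of its triangle. Read from the new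
diameter, the right subtree comes first and the left one follows, translated by a half turn. -/
theorem reachable_central {l r : Tree} (c : ℤ) (ht : (l.node r).size = d + 1)
    (ht' : (r.node l).size = d + 1) :
    (flipGraph d).Reachable (ofTree c (l.node r) ht) (ofTree (c + l.size) (r.node l) ht') := by
  have e1 := l.size_pos
  have e2 := r.size_pos
  have e3 := ht
  simp only [Tree.size] at e3
  have s1 : s(vtx d c, vtx d (c + l.size)) ∈ (ofTree c (l.node r) ht).edges :=
    mem_chords_of (Or.inr (Or.inl (l.arc_root c)))
  have s2 : s(vtx d (c + l.size), vtx d (c + (d + 1))) ∈ (ofTree c (l.node r) ht).edges :=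
    mem_chords_of (Or.inr (Or.inr (r.arc_root' (by omega))))
  have root : (l.node r).Arc c c (c + (d + 1)) := Or.inl (by omega)
  refine reachable_of_isFlip ⟨vtx d c, vtx d (c + (d + 1)), vtx d (c + l.size),
    vtx d (c + l.size + (d + 1)), mem_chords_of root,
    crosses_of_lt (by omega) (by omega) (by omega) (by omega), s1, s2, ?_, ?_, ?_⟩
  · have := (ofTree c (l.node r) ht).centrallySymmetric _ _ s1
    rwa [opp_vtx, opp_vtx] at this
  · have := (ofTree c (l.node r) ht).centrallySymmetric _ _ s2
    rw [opp_vtx, opp_vtx] at this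
    have e : vtx d (c + (d + 1) + (d + 1)) = vtx d c := by
      rw [← vtx_add_mul c 1]; congr 1; ring
    rwa [e] at this
  · simp only [ofTree]
    rw [← chords_single (c + l.size), ← chords_diff (c := c) _ root]
    · have f1 : chords d (fun u w ↦ (l.node r).Arc c u w ∧ ¬(u = c ∧ w = c + (d + 1))) =
          chords d (l.Arc c) ∪ chords d (r.Arc (c + l.size)) := by
        rw [← chords_or]
        congr 1; ext u w
        have k1 : l.Arc c u w → _ := Tree.Arc.bounds
        have k2 : r.Arc (c + l.size) u w → _ := Tree.Arc.bounds
        simp only [Tree.Arc]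
        constructor
        · rintro ⟨h | h | h, h'⟩
          · omega
          · exact Or.inl h
          · exact Or.inr h
        · rintro (h | h)
          · exact ⟨Or.inr (Or.inl h), by have := k1 h; omega⟩
          · exact ⟨Or.inr (Or.inr h), by have := k2 h; omega⟩
      rw [f1, ← chords_add (l.Arc c), ← chords_or, ← chords_or]
      congr 1; ext u w
      have k : l.Arc (c + l.size + r.size) u w ↔ l.Arc c (u - (d + 1)) (w - (d + 1)) := by
        rw [← Tree.arc_add_iff (s := d + 1) (i := c)]
        rw [show c + l.size + r.size = c + (d + 1) by omega, sub_add_cancel, sub_add_cancel]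
      simp only [Tree.Arc, k]
      rw [show r.size + l.size = d + 1 by omega]
      tauto
    · intro u w hA
      have := hA.bounds
      omega

theorem size_eq_of_rot {t t' : Tree} (h : Relation.ReflTransGen Tree.Rot t t') :
    t.size = t'.size := by
  induction h with
  | refl => rfl
  | tail _ h ih => exact ih.trans h.size_eq

theorem reachable_comb (c : ℤ) {t : Tree} (ht : t.size = d + 1) :
    (flipGraph d).Reachable (ofTree c t ht) (ofTree c (Tree.comb d) (Tree.comb_size d)) := by
  obtain ⟨n, hn⟩ := t.exists_rot_comb
  have := size_eq_of_rot hn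
  rw [Tree.comb_size] at this
  obtain rfl : n = d := by omega
  exact reachable_reflTransGen hn c _ _

/-- The left subtree of the comb is a single leaf, so flipping its diameter advances the diameter by
one vertex. What results is brought back to a comb by rotations. -/
theorem reachable_succ (hd : 0 < d) (c : ℤ) : (flipGraph d).Reachable
    (ofTree c (Tree.comb d) (Tree.comb_size d)) (ofTree (c + 1) (Tree.comb d) (Tree.comb_size d)) := by
  obtain ⟨n, rfl⟩ := Nat.exists_eq_succ_of_ne_zero hd.ne'
  have h : ((Tree.comb n).node Tree.leaf).size = ((n + 1 : ℕ) : ℤ) + 1 := by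
    simp only [Tree.size, Tree.comb_size]; push_cast; ring
  exact (reachable_central (l := Tree.leaf) (r := Tree.comb n) c
    (Tree.comb_size (n + 1)) h).trans
    (reachable_comb _ _)

theorem reachable_ofTree (hd : 0 < d) (c : ℤ) (n : ℕ) {t t' : Tree} (ht : t.size = d + 1)
    (ht' : t'.size = d + 1) : (flipGraph d).Reachable (ofTree c t ht) (ofTree (c + n) t' ht') := by
  refine (reachable_comb c ht).trans (.trans ?_ (reachable_comb _ ht').symm)
  induction n with
  | zero => simp
  | succ n ih =>
    rw [Nat.cast_succ, ← add_assoc]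
    exact ih.trans (reachable_succ hd _)

end CSTriangulation

/-! ### Flips as exchanges of triangles up to the central symmetry -/

theorem opp_opp (x : Vertex d) : opp (opp x) = x := by
  rw [← vtx_cast x, opp_vtx, opp_vtx, ← vtx_add_mul (x.val : ℤ) 1]
  congr 1; ring

theorem opp_ne (x : Vertex d) : opp x ≠ x := by
  rw [← vtx_cast x, opp_vtx]
  intro h
  have := vtx_eq_of_lt (z := x.val) (by omega) (by omega) (by omega) (by omega) h
  omega

/-- This ensures that the sides of the quadrilateral survive a flip, even when a removed edge is a
diameter. -/
theorem not_mem_pair_of_share {p q r : Vertex d} (h : q ≠ r) :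
    s(p, q) ∉ ({s(p, r), s(opp p, opp r)} : Set (Sym2 (Vertex d))) := by
  rintro (h' | h')
  · rcases Sym2.eq_iff.1 h' with ⟨-, h'⟩ | ⟨h1, h2⟩
    · exact h h'
    · exact h (h2.trans h1)
  · rcases Sym2.eq_iff.1 h' with ⟨h1, -⟩ | ⟨h1, h2⟩
    · exact opp_ne _ h1.symm
    · rw [h1, opp_opp] at h2
      exact h h2

theorem vtx_add_full (x : ℤ) : vtx d (x + (2 * d + 2)) = vtx d x := by
  simpa using vtx_add_mul (d := d) x 1

namespace CSTriangulation

/-- `T.Side x y` says that the edge between the vertices labelled `x` and `y` belongs to `T`. -/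
def Side (T : CSTriangulation d) (x y : ℤ) : Prop := s(vtx d x, vtx d y) ∈ T.edges

variable {T T' : CSTriangulation d}

theorem Side.symm {x y : ℤ} (h : T.Side x y) : T.Side y x := by
  rwa [Side, Sym2.eq_swap]

theorem Side.add {x y : ℤ} (h : T.Side x y) : T.Side (x + (d + 1)) (y + (d + 1)) := by
  have := T.centrallySymmetric _ _ h
  rwa [opp_vtx, opp_vtx] at this

theorem side_full_left {x y : ℤ} : T.Side (x + (2 * d + 2)) y ↔ T.Side x y := by
  rw [Side, vtx_add_full, Side]

theorem side_full_right {x y : ℤ} : T.Side x (y + (2 * d + 2)) ↔ T.Side x y := by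
  rw [Side, vtx_add_full, Side]

theorem Side.sub {x y : ℤ} (h : T.Side x y) : T.Side (x - (d + 1)) (y - (d + 1)) := by
  rw [← side_full_left, ← side_full_right]
  convert h.add using 1 <;> ring

theorem side_add_iff {x y : ℤ} (s : ℤ) :
    T.Side (x + s * (d + 1)) (y + s * (d + 1)) ↔ T.Side x y := by
  induction s using Int.induction_on with
  | zero => simp
  | succ i ih =>
    rw [← ih]
    have e (x : ℤ) : x + ((i : ℤ) + 1) * (d + 1) = x + i * (d + 1) + (d + 1) := by ring
    rw [e, e]
    exact ⟨fun h ↦ by simpa using h.sub, Side.add⟩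
  | pred i ih =>
    rw [← ih]
    have e (x : ℤ) : x + (-(i : ℤ) - 1) * (d + 1) = x + -i * (d + 1) - (d + 1) := by ring
    rw [e, e]
    exact ⟨fun h ↦ by simpa using h.add, Side.sub⟩

theorem Side.not_cross {x u y w : ℤ} (h : T.Side x y) (h' : T.Side u w) (h1 : x < u) (h2 : u < y)
    (h3 : y < w) (h4 : w < x + (2 * d + 2)) : False :=
  T.isTriangulation.1.2 _ h _ h' (crosses_of_lt h1 h2 h3 h4)

/-- `(l, j, r)` is a triangle of `T`. -/
def IsTri (T : CSTriangulation d) (l j r : ℤ) : Prop :=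
  l < j ∧ j < r ∧ r ≤ l + (d + 1) ∧ T.Side l j ∧ T.Side j r ∧ T.Side l r

theorem isTri_add_iff {l j r : ℤ} (s : ℤ) :
    T.IsTri (l + s * (d + 1)) (j + s * (d + 1)) (r + s * (d + 1)) ↔ T.IsTri l j r := by
  simp only [IsTri, side_add_iff]
  refine ⟨fun h ↦ ⟨?_, ?_, ?_, h.2.2.2⟩, fun h ↦ ⟨?_, ?_, ?_, h.2.2.2⟩⟩ <;> linarith [h.1, h.2.1, h.2.2.1]

open Classical in
/-- The triangles of `T` up to the central symmetry. -/
noncomputable def tri (T : CSTriangulation d) : Finset (ℤ × ℤ × ℤ) :=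
  (Finset.Ico (0 : ℤ) (d + 1) ×ˢ Finset.Ico (0 : ℤ) (2 * d + 3) ×ˢ
    Finset.Ico (0 : ℤ) (2 * d + 3)).filter fun p ↦ T.IsTri p.1 p.2.1 p.2.2

theorem mem_tri {l j r : ℤ} : (l, j, r) ∈ T.tri ↔ 0 ≤ l ∧ l < d + 1 ∧ T.IsTri l j r := by
  simp only [tri, Finset.mem_filter, Finset.mem_product, Finset.mem_Ico]
  constructor
  · rintro ⟨⟨h, -⟩, h'⟩
    exact ⟨h.1, h.2, h'⟩
  · rintro ⟨h, h', k⟩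
    have := k.1; have := k.2.1; have := k.2.2.1
    exact ⟨⟨⟨h, h'⟩, ⟨by omega, by omega⟩, ⟨by omega, by omega⟩⟩, k⟩

/-- The translate of a triple of integers by a multiple of `d + 1` that makes the first one reduced
modulo `d + 1`. -/
def reduce (d : ℕ) (l j r : ℤ) : ℤ × ℤ × ℤ :=
  (l + -(l / (d + 1)) * (d + 1), j + -(l / (d + 1)) * (d + 1), r + -(l / (d + 1)) * (d + 1))

theorem reduce_bounds (l : ℤ) : 0 ≤ l + -(l / (d + 1)) * (d + 1) ∧
    l + -(l / (d + 1)) * (d + 1) < d + 1 := by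
  have hN : (0 : ℤ) < d + 1 := by omega
  have e1 := Int.emod_nonneg l hN.ne'
  have e2 := Int.emod_lt_of_pos l hN
  have e3 := Int.emod_add_mul_ediv l (d + 1)
  constructor <;> nlinarith

theorem reduce_mem_tri {l j r : ℤ} : reduce d l j r ∈ T.tri ↔ T.IsTri l j r := by
  rw [reduce, mem_tri, isTri_add_iff]
  have := reduce_bounds (d := d) l
  tauto

theorem reduce_eq {u v w s : ℤ} (h1 : 0 ≤ u + s * (d + 1)) (h2 : u + s * (d + 1) < d + 1) :
    (u + s * (d + 1), v + s * (d + 1), w + s * (d + 1)) = reduce d u v w := by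
  have ⟨h3, h4⟩ := reduce_bounds (d := d) u
  have : s = -(u / (d + 1)) := by
    have k1 : s - -(u / (d + 1)) < 1 := by by_contra!; nlinarith
    have k2 : -1 < s - -(u / (d + 1)) := by by_contra!; nlinarith
    omega
  rw [reduce, this]

theorem tri_sdiff_eq {u v w u' v' w' : ℤ} (h1 : T.IsTri u v w) (h2 : T.IsTri u' v' w')
    (h3 : ¬ T'.IsTri u v w) (h4 : ¬ T'.IsTri u' v' w')
    (h : ∀ l j r, T.IsTri l j r → ¬ T'.IsTri l j r → ∃ s : ℤ,
      (l, j, r) = (u + s * (d + 1), v + s * (d + 1), w + s * (d + 1)) ∨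
      (l, j, r) = (u' + s * (d + 1), v' + s * (d + 1), w' + s * (d + 1))) :
    T.tri \ T'.tri = {reduce d u v w, reduce d u' v' w'} := by
  ext ⟨l, j, r⟩
  rw [Finset.mem_sdiff, Finset.mem_insert, Finset.mem_singleton]
  constructor
  · rintro ⟨k1, k2⟩
    rw [mem_tri] at k1 k2
    obtain ⟨s, hs | hs⟩ := h l j r k1.2.2 fun k ↦ k2 ⟨k1.1, k1.2.1, k⟩
    · left
      obtain ⟨rfl, rfl, rfl⟩ : _ ∧ _ ∧ _ := by simpa using hs
      exact reduce_eq k1.1 k1.2.1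
    · right
      obtain ⟨rfl, rfl, rfl⟩ : _ ∧ _ ∧ _ := by simpa using hs
      exact reduce_eq k1.1 k1.2.1
  · rintro (h | h) <;> rw [h, reduce_mem_tri, reduce_mem_tri] <;> exact ⟨‹_›, ‹_›⟩

theorem reduce_ne {u v w u' v' w' : ℤ} (h : w - u ≠ w' - u') :
    reduce d u v w ≠ reduce d u' v' w' := by
  intro he
  simp only [reduce, Prod.mk.injEq] at he
  omega

/-- `T` and `T'` differ by the exchange of the diagonals of the quadrilateral `a, b, c, e`. -/
structure Exchange (T T' : CSTriangulation d) (a b c e : ℤ) : Prop where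
  lt₁ : a < b
  lt₂ : b < c
  lt₃ : c < e
  lt₄ : e < a + (2 * d + 2)
  ac : T.Side a c
  be : T'.Side b e
  ab : T.Side a b
  bc : T.Side b c
  ce : T.Side c e
  ea : T.Side e a
  ab' : T'.Side a b
  bc' : T'.Side b c
  ce' : T'.Side c e
  ea' : T'.Side e a
  eq_ac : ∀ x y, T.Side x y → ¬ T'.Side x y → s(vtx d x, vtx d y) = s(vtx d a, vtx d c) ∨
    s(vtx d x, vtx d y) = s(vtx d (a + (d + 1)), vtx d (c + (d + 1)))
  eq_be : ∀ x y, T'.Side x y → ¬ T.Side x y → s(vtx d x, vtx d y) = s(vtx d b, vtx d e) ∨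
    s(vtx d x, vtx d y) = s(vtx d (b + (d + 1)), vtx d (e + (d + 1)))

/-- The inverse exchange is again an exchange, read from the next vertex of the quadrilateral. Each
rotation swaps the two triangulations. -/
theorem Exchange.rotate {a b c e : ℤ} (h : Exchange T T' a b c e) :
    Exchange T' T b c e (a + (2 * d + 2)) := by
  have e1 : vtx d (a + (2 * d + 2) + (d + 1)) = vtx d (a + (d + 1)) := by
    rw [← vtx_add_full (a + (d + 1))]; congr 1; ring
  refine ⟨h.lt₂, h.lt₃, h.lt₄, by linarith [h.lt₁], h.be, side_full_right.2 h.ac.symm, h.bc', h.ce',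
    side_full_right.2 h.ea', side_full_left.2 h.ab', h.bc, h.ce, side_full_right.2 h.ea,
    side_full_left.2 h.ab, h.eq_be, fun x y h1 h2 ↦ ?_⟩
  rw [vtx_add_full, e1, Sym2.eq_swap (a := vtx d c), Sym2.eq_swap (a := vtx d (c + _))]
  exact h.eq_ac x y h1 h2

theorem exists_exchange (h : IsFlip T T') : ∃ a b c e, Exchange T T' a b c e := by
  obtain ⟨x, x', y, y', h1, h2, h3, h4, h5, h6, h7⟩ := h
  have key : ∀ y y' : Vertex d, s(x, y) ∈ T.edges → s(y, x') ∈ T.edges → s(x', y') ∈ T.edges →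
      s(y', x) ∈ T.edges →
      T'.edges = T.edges \ {s(x, x'), s(opp x, opp x')} ∪ {s(y, y'), s(opp y, opp y')} →
      ∀ a b c e : ℤ, a < b → b < c → c < e → e < a + (2 * d + 2) → vtx d a = x → vtx d b = y →
      vtx d c = x' → vtx d e = y' → Exchange T T' a b c e := by
    rintro y y' h3 h4 h5 h6 h7 a b c e i1 i2 i3 i4 rfl rfl rfl rfl
    have n1 : vtx d b ≠ vtx d a := fun h ↦ by
      have := vtx_eq_of_lt (z := a) (by omega) (by omega) (by omega) (by omega) h; omega
    have n2 : vtx d b ≠ vtx d c := fun h ↦ by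
      have := vtx_eq_of_lt (z := a) (by omega) (by omega) (by omega) (by omega) h; omega
    have n3 : vtx d e ≠ vtx d a := fun h ↦ by
      have := vtx_eq_of_lt (z := a) (by omega) (by omega) (by omega) (by omega) h; omega
    have n4 : vtx d e ≠ vtx d c := fun h ↦ by
      have := vtx_eq_of_lt (z := a) (by omega) (by omega) (by omega) (by omega) h; omega
    have swap : ({s(vtx d a, vtx d c), s(opp (vtx d a), opp (vtx d c))} : Set (Sym2 (Vertex d))) =
        {s(vtx d c, vtx d a), s(opp (vtx d c), opp (vtx d a))} := by
      rw [Sym2.eq_swap, Sym2.eq_swap (a := opp (vtx d a))]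
    refine ⟨i1, i2, i3, i4, h1, ?_, h3, h4, h5, h6, ?_, ?_, ?_, ?_, fun u w k1 k2 ↦ ?_,
      fun u w k1 k2 ↦ ?_⟩
    · rw [Side, h7]
      exact Or.inr (Or.inl rfl)
    · rw [Side, h7]
      exact Or.inl ⟨h3, not_mem_pair_of_share n2⟩
    · rw [Side, h7, swap, Sym2.eq_swap (a := vtx d b) (b := vtx d c)]
      rw [Sym2.eq_swap] at h4
      exact Or.inl ⟨h4, not_mem_pair_of_share n1⟩
    · rw [Side, h7, swap]
      exact Or.inl ⟨h5, not_mem_pair_of_share n3⟩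
    · rw [Side, h7, Sym2.eq_swap (a := vtx d e)]
      rw [Sym2.eq_swap] at h6
      exact Or.inl ⟨h6, not_mem_pair_of_share n4⟩
    · rw [Side, h7] at k2
      rw [← opp_vtx, ← opp_vtx]
      by_contra hc
      exact k2 (Or.inl ⟨k1, hc⟩)
    · rw [Side, h7] at k1
      rw [← opp_vtx, ← opp_vtx]
      rcases k1 with k1 | k1
      · exact absurd k1.1 k2
      · exact k1
  -- Starting from `x`, the vertices `y` and `y'` may be met in either order.
  obtain ⟨a, b, c, e, i1, i2, i3, i4, i5, i6, ⟨i7, i8⟩ | ⟨i7, i8⟩⟩ := exists_lift_of_crosses h2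
  · exact ⟨a, b, c, e, key y y' h3 h4 h5 h6 h7 a b c e i1 i2 i3 i4 i5 i7 i6 i8⟩
  · refine ⟨a, b, c, e, key y' y ?_ ?_ ?_ ?_ ?_ a b c e i1 i2 i3 i4 i5 i7 i6 i8⟩
    · rwa [Sym2.eq_swap]
    · rwa [Sym2.eq_swap]
    · rwa [Sym2.eq_swap]
    · rwa [Sym2.eq_swap]
    · rw [h7, Sym2.eq_swap (a := y), Sym2.eq_swap (a := opp y)]

theorem Exchange.not_side_ac {a b c e : ℤ} (h : Exchange T T' a b c e) : ¬ T'.Side a c :=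
  fun k ↦ k.not_cross h.be h.lt₁ h.lt₂ h.lt₃ h.lt₄

theorem Exchange.not_side_be {a b c e : ℤ} (h : Exchange T T' a b c e) : ¬ T.Side b e :=
  fun k ↦ h.ac.not_cross k h.lt₁ h.lt₂ h.lt₃ h.lt₄

theorem Exchange.shift_ac {a b c e : ℤ} (h : Exchange T T' a b c e) (hN : c ≤ a + (d + 1)) {x y : ℤ}
    (h1 : x < y) (h2 : y ≤ x + (d + 1)) (h3 : T.Side x y) (h4 : ¬ T'.Side x y) :
    ∃ s : ℤ, a = x + s * (d + 1) ∧ c = y + s * (d + 1) := by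
  have := h.lt₁; have := h.lt₂
  rcases h.eq_ac x y h3 h4 with k | k
  · exact eq_of_vtx_pair_eq (by omega) hN h1 h2 k.symm
  · obtain ⟨s, k1, k2⟩ := eq_of_vtx_pair_eq (by omega) (by omega) h1 h2 k.symm
    exact ⟨s - 1, by linarith, by linarith⟩

theorem Exchange.shift_be {a b c e : ℤ} (h : Exchange T T' a b c e) (hN : e ≤ b + (d + 1)) {x y : ℤ}
    (h1 : x < y) (h2 : y ≤ x + (d + 1)) (h3 : T'.Side x y) (h4 : ¬ T.Side x y) :
    ∃ s : ℤ, b = x + s * (d + 1) ∧ e = y + s * (d + 1) := by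
  have := h.lt₂; have := h.lt₃
  rcases h.eq_be x y h3 h4 with k | k
  · exact eq_of_vtx_pair_eq (by omega) hN h1 h2 k.symm
  · obtain ⟨s, k1, k2⟩ := eq_of_vtx_pair_eq (by omega) (by omega) h1 h2 k.symm
    exact ⟨s - 1, by linarith, by linarith⟩

/-- A triangle one of whose sides is a diagonal of a quadrilateral is one of its halves. -/
theorem IsTri.eq_or_eq {a b c e : ℤ} (h1 : a < b) (h2 : b < c) (h3 : c < e) (h4 : e ≤ a + (d + 1))
    (ab : T.Side a b) (bc : T.Side b c) (ce : T.Side c e) (ea : T.Side e a) {l j r : ℤ}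
    (h : T.IsTri l j r) :
    ((l = a ∧ j = c) ∨ (j = a ∧ r = c) ∨ (l = a ∧ r = c) →
      ((l = a ∧ j = b ∧ r = c) ∨ (l = a ∧ j = c ∧ r = e))) ∧
    ((l = b ∧ j = e) ∨ (j = b ∧ r = e) ∨ (l = b ∧ r = e) →
      ((l = a ∧ j = b ∧ r = e) ∨ (l = b ∧ j = c ∧ r = e))) := by
  obtain ⟨k1, k2, k3, s1, s2, s3⟩ := h
  constructor
  · rintro (⟨rfl, rfl⟩ | ⟨rfl, rfl⟩ | ⟨rfl, rfl⟩)
    · rcases lt_trichotomy r e with k | k | k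
      · exact (s3.not_cross ce (by omega) (by omega) k (by omega)).elim
      · exact Or.inr ⟨rfl, rfl, k⟩
      · exact (ea.symm.not_cross s2 (by omega) h3 k (by omega)).elim
    · exact (s3.not_cross ea.symm (by omega) (by omega) h3 (by omega)).elim
    · rcases lt_trichotomy j b with k | k | k
      · exact (ab.not_cross s2 (by omega) (by omega) (by omega) (by omega)).elim
      · exact Or.inl ⟨rfl, k, rfl⟩
      · exact (s1.not_cross bc (by omega) (by omega) (by omega) (by omega)).elim
  · rintro (⟨rfl, rfl⟩ | ⟨rfl, rfl⟩ | ⟨rfl, rfl⟩)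
    · exact (s3.not_cross (side_full_right.2 ea) (by omega) (by omega) (by omega) (by omega)).elim
    · rcases lt_trichotomy l a with k | k | k
      · exact (s1.not_cross ea.symm (by omega) (by omega) (by omega) (by omega)).elim
      · exact Or.inl ⟨k, rfl, rfl⟩
      · exact (ab.not_cross s3 (by omega) (by omega) (by omega) (by omega)).elim
    · rcases lt_trichotomy j c with k | k | k
      · exact (bc.not_cross s2 (by omega) (by omega) (by omega) (by omega)).elim
      · exact Or.inr ⟨rfl, k, rfl⟩
      · exact (s1.not_cross ce (by omega) (by omega) (by omega) (by omega)).elim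

theorem Exchange.tri_sdiff {a b c e : ℤ} (h : Exchange T T' a b c e) (hN : e ≤ a + (d + 1)) :
    T.tri \ T'.tri = {reduce d a b c, reduce d a c e} ∧
      T'.tri \ T.tri = {reduce d a b e, reduce d b c e} := by
  have i1 := h.lt₁; have i2 := h.lt₂; have i3 := h.lt₃; have i4 := h.lt₄
  constructor
  · refine tri_sdiff_eq ⟨i1, i2, by omega, h.ab, h.bc, h.ac⟩ ⟨by omega, i3, hN, h.ac, h.ce, h.ea.symm⟩
      (fun k ↦ h.not_side_ac k.2.2.2.2.2) (fun k ↦ h.not_side_ac k.2.2.2.1) fun l j r k1 k2 ↦ ?_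
    have hs : ∃ s : ℤ, (l + s * (d + 1) = a ∧ j + s * (d + 1) = c) ∨
        (j + s * (d + 1) = a ∧ r + s * (d + 1) = c) ∨
        (l + s * (d + 1) = a ∧ r + s * (d + 1) = c) := by
      obtain ⟨e1, e2, e3, s1, s2, s3⟩ := k1
      simp only [IsTri, e1, e2, e3, true_and, not_and_or] at k2
      rcases k2 with k2 | k2 | k2
      · obtain ⟨s, u, w⟩ := h.shift_ac (by omega) (by omega) (by omega) s1 k2
        exact ⟨s, Or.inl ⟨u.symm, w.symm⟩⟩
      · obtain ⟨s, u, w⟩ := h.shift_ac (by omega) (by omega) (by omega) s2 k2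
        exact ⟨s, Or.inr (Or.inl ⟨u.symm, w.symm⟩)⟩
      · obtain ⟨s, u, w⟩ := h.shift_ac (by omega) (by omega) (by omega) s3 k2
        exact ⟨s, Or.inr (Or.inr ⟨u.symm, w.symm⟩)⟩
    obtain ⟨s, hs⟩ := hs
    refine ⟨-s, ?_⟩
    rcases (((isTri_add_iff s).2 k1).eq_or_eq i1 i2 i3 hN h.ab h.bc h.ce h.ea).1 hs with
      ⟨u, v, w⟩ | ⟨u, v, w⟩
    · left; ext <;> linarith
    · right; ext <;> linarith
  · refine tri_sdiff_eq ⟨i1, by omega, by omega, h.ab', h.be, h.ea'.symm⟩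
      ⟨by omega, i3, by omega, h.bc', h.ce', h.be⟩
      (fun k ↦ h.not_side_be k.2.2.2.2.1) (fun k ↦ h.not_side_be k.2.2.2.2.2) fun l j r k1 k2 ↦ ?_
    have hs : ∃ s : ℤ, (l + s * (d + 1) = b ∧ j + s * (d + 1) = e) ∨
        (j + s * (d + 1) = b ∧ r + s * (d + 1) = e) ∨
        (l + s * (d + 1) = b ∧ r + s * (d + 1) = e) := by
      obtain ⟨e1, e2, e3, s1, s2, s3⟩ := k1
      simp only [IsTri, e1, e2, e3, true_and, not_and_or] at k2
      rcases k2 with k2 | k2 | k2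
      · obtain ⟨s, u, w⟩ := h.shift_be (by omega) (by omega) (by omega) s1 k2
        exact ⟨s, Or.inl ⟨u.symm, w.symm⟩⟩
      · obtain ⟨s, u, w⟩ := h.shift_be (by omega) (by omega) (by omega) s2 k2
        exact ⟨s, Or.inr (Or.inl ⟨u.symm, w.symm⟩)⟩
      · obtain ⟨s, u, w⟩ := h.shift_be (by omega) (by omega) (by omega) s3 k2
        exact ⟨s, Or.inr (Or.inr ⟨u.symm, w.symm⟩)⟩
    obtain ⟨s, hs⟩ := hs
    refine ⟨-s, ?_⟩
    rcases (((isTri_add_iff s).2 k1).eq_or_eq i1 i2 i3 hN h.ab' h.bc' h.ce' h.ea').2 hs with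
      ⟨u, v, w⟩ | ⟨u, v, w⟩
    · left; ext <;> linarith
    · right; ext <;> linarith

/-- A quadrilateral whose diagonals are exchanged and that is contained in no half of the polygon
is centrally symmetric. -/
theorem Exchange.central {a b c e : ℤ} (h : Exchange T T' a b c e) (g1 : a + (d + 1) < e)
    (g2 : b < a + (d + 1)) (g3 : c < b + (d + 1)) (g4 : e < c + (d + 1)) :
    c = a + (d + 1) ∧ e = b + (d + 1) := by
  have i1 := h.lt₁; have i2 := h.lt₂; have i3 := h.lt₃; have i4 := h.lt₄
  have hc : c = a + (d + 1) := by
    rcases lt_trichotomy c (a + (d + 1)) with k | k | k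
    · exact (h.ce.not_cross h.ac.add k (by omega) (by omega) (by omega)).elim
    · exact k
    · refine (Side.not_cross (x := c - (d + 1)) (y := a + (d + 1)) ?_ h.bc (by omega) (by omega)
        (by omega) (by omega)).elim
      rw [← side_full_left]
      convert h.ac.add.symm using 1; ring
  subst hc
  refine ⟨rfl, ?_⟩
  rcases lt_trichotomy e (b + (d + 1)) with k | k | k
  · exact (h.ab.add.not_cross (side_full_right.2 h.ea) i3 k (by omega) (by omega)).elim
  · exact k
  · have : T.Side (b + (d + 1)) (a + (2 * d + 2)) := by convert h.bc.add using 1; ring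
    exact (h.ce.not_cross this (by omega) k (by omega) (by omega)).elim

theorem IsTri.eq_of_central {a b l j r : ℤ} (ab : T.Side a b) (bc : T.Side b (a + (d + 1)))
    (h : T.IsTri l j r) (hl : l = a) (hr : r = a + (d + 1)) (h1 : a < b) (h2 : b < a + (d + 1)) :
    j = b := by
  obtain ⟨k1, k2, k3, s1, s2, s3⟩ := h
  subst hl hr
  rcases lt_trichotomy j b with k | k | k
  · exact (ab.not_cross s2 k1 k h2 (by omega)).elim
  · exact k
  · exact (s1.not_cross bc h1 k k2 (by omega)).elim

theorem tri_sdiff_eq_singleton {a b : ℤ} (h1 : T.IsTri a b (a + (d + 1)))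
    (h3 : ¬ T'.Side a (a + (d + 1)))
    (h : ∀ x y : ℤ, x < y → y ≤ x + (d + 1) → T.Side x y → ¬ T'.Side x y →
      ∃ s : ℤ, a = x + s * (d + 1) ∧ a + (d + 1) = y + s * (d + 1)) :
    T.tri \ T'.tri = {reduce d a b (a + (d + 1))} := by
  -- The two-triangle statement is used with both triangles equal.
  rw [tri_sdiff_eq h1 h1 (fun k ↦ h3 k.2.2.2.2.2) (fun k ↦ h3 k.2.2.2.2.2) fun l j r k1 k2 ↦ ?_]
  · simp
  have k3 := k1
  obtain ⟨e1, e2, e3, s1, s2, s3⟩ := k3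
  have hs : ∃ s : ℤ, a = l + s * (d + 1) ∧ a + (d + 1) = r + s * (d + 1) := by
    simp only [IsTri, e1, e2, e3, true_and, not_and_or] at k2
    rcases k2 with k2 | k2 | k2
    -- Only the long side can be the lost diameter: the other two sides have length less than `d +
    -- 1`.
    · obtain ⟨s, u, w⟩ := h _ _ (by omega) (by omega) s1 k2
      omega
    · obtain ⟨s, u, w⟩ := h _ _ (by omega) (by omega) s2 k2
      omega
    · exact h _ _ (by omega) (by omega) s3 k2
  obtain ⟨s, u, w⟩ := hs
  have := ((isTri_add_iff s).2 k1).eq_of_central h1.2.2.2.1 h1.2.2.2.2.1 u.symm w.symm h1.1 h1.2.1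
  exact ⟨-s, Or.inl (by ext <;> linarith)⟩

theorem Exchange.tri_sdiff_central {a b : ℤ} (h : Exchange T T' a b (a + (d + 1)) (b + (d + 1))) :
    T.tri \ T'.tri = {reduce d a b (a + (d + 1))} ∧
      T'.tri \ T.tri = {reduce d b (a + (d + 1)) (b + (d + 1))} := by
  have i1 := h.lt₁; have i2 := h.lt₂
  exact ⟨tri_sdiff_eq_singleton ⟨i1, i2, le_rfl, h.ab, h.bc, h.ac⟩ h.not_side_ac
    fun x y ↦ h.shift_ac le_rfl,
    tri_sdiff_eq_singleton ⟨i2, by omega, le_rfl, h.bc', h.ce', h.be⟩ h.not_side_be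
    fun x y ↦ h.shift_be le_rfl⟩

/-! ### Potentials of bounded variation along flips -/

/-- The sum of a function over the triangles of `T` up to the central symmetry. -/
noncomputable def potential (φ : ℤ → ℤ → ℤ → ℤ) (T : CSTriangulation d) : ℤ :=
  ∑ p ∈ T.tri, φ p.1 p.2.1 p.2.2

/-- A function of triples of integers with bounded variation along flips. -/
structure FlipBounded (d : ℕ) (φ : ℤ → ℤ → ℤ → ℤ) (D : ℤ) : Prop where
  periodic : ∀ l j r : ℤ, φ (l + (d + 1)) (j + (d + 1)) (r + (d + 1)) = φ l j r
  quad : ∀ a b c e : ℤ, a < b → b < c → c < e → e ≤ a + (d + 1) →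
    |φ a b c + φ a c e - φ a b e - φ b c e| ≤ D
  central : ∀ a b : ℤ, a < b → b < a + (d + 1) →
    |φ a b (a + (d + 1)) - φ b (a + (d + 1)) (b + (d + 1))| ≤ D

variable {φ : ℤ → ℤ → ℤ → ℤ} {D : ℤ}

theorem FlipBounded.add_mul (hφ : FlipBounded d φ D) (l j r s : ℤ) :
    φ (l + s * (d + 1)) (j + s * (d + 1)) (r + s * (d + 1)) = φ l j r := by
  induction s using Int.induction_on with
  | zero => simp
  | succ i ih =>
    rw [← ih, ← hφ.periodic (l + i * (d + 1))]
    congr 1 <;> ring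
  | pred i ih =>
    rw [← ih, ← hφ.periodic (l + (-i - 1) * (d + 1))]
    congr 1 <;> ring

theorem FlipBounded.reduce (hφ : FlipBounded d φ D) (l j r : ℤ) :
    φ (reduce d l j r).1 (reduce d l j r).2.1 (reduce d l j r).2.2 = φ l j r :=
  hφ.add_mul l j r _

theorem Exchange.abs_potential_sub_le (hφ : FlipBounded d φ D) {a b c e : ℤ}
    (h : Exchange T T' a b c e) (hN : e ≤ a + (d + 1)) :
    |potential φ T - potential φ T'| ≤ D := by
  have i1 := h.lt₁; have i2 := h.lt₂; have i3 := h.lt₃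
  rw [potential, potential, ← Finset.sum_sdiff_sub_sum_sdiff, (h.tri_sdiff hN).1, (h.tri_sdiff hN).2,
    Finset.sum_pair (reduce_ne (by omega)), Finset.sum_pair (reduce_ne (by omega))]
  simp only [hφ.reduce]
  rw [← sub_sub]
  exact hφ.quad a b c e i1 i2 i3 hN

theorem abs_potential_sub_le_of_isFlip (hφ : FlipBounded d φ D) (h : IsFlip T T') :
    |potential φ T - potential φ T'| ≤ D := by
  obtain ⟨a, b, c, e, h⟩ := exists_exchange h
  -- If some half of the polygon contains the quadrilateral, rotations make it start at the end of
  -- that half. Otherwise it is centrally symmetric.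
  by_cases g1 : e ≤ a + (d + 1)
  · exact h.abs_potential_sub_le hφ g1
  by_cases g2 : a + (d + 1) ≤ b
  · rw [abs_sub_comm]
    exact h.rotate.abs_potential_sub_le hφ (by omega)
  by_cases g3 : b + (d + 1) ≤ c
  · exact h.rotate.rotate.abs_potential_sub_le hφ (by omega)
  by_cases g4 : c + (d + 1) ≤ e
  · rw [abs_sub_comm]
    exact h.rotate.rotate.rotate.abs_potential_sub_le hφ (by omega)
  obtain ⟨rfl, rfl⟩ := h.central (by omega) (by omega) (by omega) (by omega)
  rw [potential, potential, ← Finset.sum_sdiff_sub_sum_sdiff, h.tri_sdiff_central.1,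
    h.tri_sdiff_central.2, Finset.sum_singleton, Finset.sum_singleton, hφ.reduce, hφ.reduce]
  exact hφ.central a b h.lt₁ h.lt₂

theorem abs_potential_sub_le_length (hφ : FlipBounded d φ D) (w : (flipGraph d).Walk T T') :
    |potential φ T - potential φ T'| ≤ D * w.length := by
  induction w with
  | nil => simp
  | @cons u v w h p ih =>
    have hle : |potential φ u - potential φ v| ≤ D := by
      rcases ((SimpleGraph.fromRel_adj _ _ _).1 h).2 with h | h
      · exact abs_potential_sub_le_of_isFlip hφ h
      · rw [abs_sub_comm]
        exact abs_potential_sub_le_of_isFlip hφ h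
    have := abs_sub_le (potential φ u) (potential φ v) (potential φ w)
    rw [SimpleGraph.Walk.length_cons]
    push_cast
    linarith

theorem abs_potential_sub_le_dist (hφ : FlipBounded d φ D) (h : (flipGraph d).Reachable T T') :
    |potential φ T - potential φ T'| ≤ D * (flipGraph d).dist T T' := by
  obtain ⟨w, hw⟩ := h.exists_walk_length_eq_dist
  rw [← hw]
  exact abs_potential_sub_le_length hφ w

end CSTriangulation

/-! ### The functions from which the weight is built, and their inequalities -/

namespace Weight

/-- The function that climbs from `1 - 2 * k` to zero on `[1, 2 * k]` and vanishes elsewhere. -/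
def tent (k x : ℤ) : ℤ := if 1 ≤ x ∧ x ≤ 2 * k then x - 2 * k else 0

/-- The function `tent`, modified on `[S, S + k - 4]`, where it climbs from `4 - k` to zero. -/
def tent' (k S x : ℤ) : ℤ := if S ≤ x then min 0 (4 - k + x - S) else tent k x

/-- The positive part of `k - x` for positive `x`, extended by zero. -/
def ramp (k x : ℤ) : ℤ := if 1 ≤ x then max 0 (k - x) else 0

/-- A step from `2 * k` to zero. -/
def step (k x : ℤ) : ℤ := if x ≤ 0 then 2 * k else 0

/-- The weight of a triangle two of whose vertices are among `0, …, n`. -/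
def ear (k S x y : ℤ) : ℤ :=
  if x ≤ 0 then tent' k S y - 2 * k else if x = 1 then tent' k S y - 1 else tent k y

/-- The weight of a triangle one of whose vertices is among `0, …, n`, up to a correction for the
triangles that have a boundary edge. -/
def fan (k S x y : ℤ) : ℤ :=
  if y ≤ 0 then min (x - y) k
  else if x = y + 1 then (if x = S then max 1 (k - 2) else 1)
  else min (x - y) k + tent' k S y - tent k x

variable {k S : ℤ}

theorem ear_of_nonpos {x y : ℤ} (h : x ≤ 0) : ear k S x y = tent' k S y - 2 * k := if_pos h

theorem ear_one (y : ℤ) : ear k S 1 y = tent' k S y - 1 := by simp [ear]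

theorem ear_of_two_le {x y : ℤ} (h : 2 ≤ x) : ear k S x y = tent k y := by
  rw [ear, if_neg (by omega), if_neg (by omega)]

theorem fan_of_nonpos {x y : ℤ} (h : y ≤ 0) : fan k S x y = min (x - y) k := if_pos h

theorem fan_succ {x y : ℤ} (h : 1 ≤ y) (hx : x = y + 1) :
    fan k S x y = if x = S then max 1 (k - 2) else 1 := by
  rw [fan, if_neg (by omega), if_pos hx]

theorem fan_of_lt {x y : ℤ} (h : 1 ≤ y) (hx : y + 1 < x) :
    fan k S x y = min (x - y) k + tent' k S y - tent k x := by
  rw [fan, if_neg (by omega), if_neg (by omega)]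

/-- Write `N = 2 * n + S`, call `E` the vertices `0, …, n`, call `F` the vertices `n + 1, …, N - 1`,
and mark translates by `N` with a prime. An edge between `e` in `E` and `f` in `F` has the
coordinate `N - f - e`. This inequality governs the quadrilaterals `EEEF`, whose triangle `EEE` has
weight zero. -/
theorem abs_ear_le (hk : 1 ≤ k) (hS : 2 * k + 1 ≤ S) {x y z : ℤ} (h1 : x < y) (h2 : y < z) :
    |ear k S x z - ear k S y z - ear k S x y| ≤ 2 * k := by
  rw [abs_le]
  simp only [ear, tent', tent]
  split_ifs <;> omega

/-- For quadrilaterals `EEFF`, where `h` is the distance between the two vertices in `E`. -/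
theorem abs_ear_fan_le (hk : 1 ≤ k) (hS : 2 * k + 1 ≤ S) {x y h : ℤ} (h1 : y < x) (h2 : 1 ≤ h) :
    |ear k S x (x + h) - ear k S y (y + h) + fan k S (x + h) (y + h) - fan k S x y| ≤ 2 * k := by
  rw [abs_le]
  by_cases hx : x = y + 1
  · rcases lt_trichotomy y 1 with hy | hy | hy
    · rw [ear_of_nonpos (x := y) (by omega), fan_of_nonpos (x := x) (by omega)]
      rcases lt_trichotomy x 1 with hx1 | rfl | hx1
      · rw [ear_of_nonpos (by omega)]
        by_cases hyh : y + h ≤ 0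
        · rw [fan_of_nonpos hyh]
          simp only [tent', tent]
          split_ifs <;> omega
        · rw [fan_succ (by omega) (by omega)]
          simp only [tent', tent]
          split_ifs <;> omega
      · rw [ear_one, fan_succ (by omega) (by omega)]
        simp only [tent', tent]
        split_ifs <;> omega
      · omega
    · subst hy
      rw [ear_of_two_le (by omega), ear_one, fan_succ (by omega) (by omega),
        fan_succ (by omega) (by omega)]
      simp only [tent', tent]
      split_ifs <;> omega
    · rw [ear_of_two_le (by omega), ear_of_two_le (by omega), fan_succ (by omega) (by omega),
        fan_succ (by omega) (by omega)]
      simp only [tent]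
      split_ifs <;> omega
  · rcases lt_trichotomy y 1 with hy | hy | hy
    · rw [ear_of_nonpos (x := y) (by omega), fan_of_nonpos (x := x) (by omega)]
      by_cases hyh : y + h ≤ 0
      · rw [fan_of_nonpos hyh]
        simp only [ear, tent', tent]
        split_ifs <;> omega
      · rw [fan_of_lt (by omega) (by omega)]
        -- This value occurs in both `ear` and `fan` and cancels.
        generalize tent' k S (y + h) = t
        simp only [ear, tent', tent]
        split_ifs <;> omega
    · subst hy
      rw [ear_of_two_le (by omega), ear_one, fan_of_lt (by omega) (by omega),
        fan_of_lt (by omega) (by omega)]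
      simp only [tent', tent]
      split_ifs <;> omega
    · rw [ear_of_two_le (by omega), ear_of_two_le (by omega), fan_of_lt (by omega) (by omega),
        fan_of_lt (by omega) (by omega)]
      simp only [tent', tent]
      split_ifs <;> omega

/-- For quadrilaterals `EFFF`. The correction `2 * k` gathers the boundary-edge terms of the two
triangles that contain the edge `x = y + 1`. -/
theorem abs_fan_le (hk : 1 ≤ k) (hS : 2 * k + 1 ≤ S) {x y z : ℤ} (h1 : y < x) (h2 : z < y) :
    |fan k S x y + fan k S y z - fan k S x z - 2 * (if x = y + 1 then k else 0)| ≤ 2 * k := by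
  rw [abs_le]
  by_cases hx : x = y + 1
  · rw [if_pos hx]
    by_cases hy : 1 ≤ y
    · rw [fan_succ hy hx]
      by_cases hz : 1 ≤ z
      · rw [fan_of_lt (x := x) hz (by omega)]
        by_cases hyz : y = z + 1
        · rw [fan_succ hz hyz]
          simp only [tent', tent]
          split_ifs <;> omega
        · rw [fan_of_lt hz (by omega)]
          generalize tent' k S z = t
          simp only [tent]
          split_ifs <;> omega
      · rw [fan_of_nonpos (by omega), fan_of_nonpos (by omega)]
        split_ifs <;> omega
    · rw [fan_of_nonpos (y := y) (by omega), fan_of_nonpos (by omega), fan_of_nonpos (by omega)]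
      omega
  · rw [if_neg hx]
    by_cases hy : 1 ≤ y
    · rw [fan_of_lt hy (by omega)]
      by_cases hz : 1 ≤ z
      · rw [fan_of_lt (x := x) hz (by omega)]
        generalize tent k x = t
        by_cases hyz : y = z + 1
        · rw [fan_succ hz hyz]
          simp only [tent', tent]
          split_ifs <;> omega
        · rw [fan_of_lt hz (by omega)]
          generalize tent' k S z = u
          simp only [tent', tent]
          split_ifs <;> omega
      · rw [fan_of_nonpos (by omega), fan_of_nonpos (by omega)]
        simp only [tent', tent]
        split_ifs <;> omega
    · rw [fan_of_nonpos (y := y) (by omega), fan_of_nonpos (by omega), fan_of_nonpos (by omega)]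
      omega

/-- For quadrilaterals `EEFE'` and `EFE'E'` whose longest side is not a diameter. `abs_ear_ramp_le`
treats those with a diameter. -/
theorem abs_ear_add_le (hk : 1 ≤ k) (x y : ℤ) :
    |ear k S x y + 2 * k| ≤ 2 * k := by
  rw [abs_le]
  simp only [ear, tent', tent]
  split_ifs <;> omega

theorem abs_ear_ramp_le (hk : 1 ≤ k) (hS : 2 * k + 1 ≤ S) {x y : ℤ} (h1 : x < y) :
    |ear k S x y + k + ramp k y - ramp k (S - y)| ≤ 2 * k := by
  rw [abs_le]
  simp only [ear, tent', tent, ramp]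
  split_ifs <;> omega

/-- For quadrilaterals `EFFE'` on a diameter. `abs_fan_fan_le` treats the others. -/
theorem abs_fan_ramp_le (hk : 1 ≤ k) (hS : 2 * k + 1 ≤ S) {x y : ℤ} (h1 : y < x) :
    |fan k S x y + fan k S (S - y) (S - x) - 2 * (if x = y + 1 then k else 0) +
      (ramp k y - ramp k (S - y)) - (ramp k x - ramp k (S - x))| ≤ 2 * k := by
  rw [abs_le]
  by_cases hx : x = y + 1
  · rw [if_pos hx]
    by_cases hy : 1 ≤ y
    · rw [fan_succ hy hx]
      by_cases hz : 1 ≤ S - x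
      · rw [fan_succ hz (by omega)]
        simp only [ramp]
        split_ifs <;> omega
      · rw [fan_of_nonpos (by omega)]
        simp only [ramp]
        split_ifs <;> omega
    · rw [fan_of_nonpos (y := y) (by omega), fan_succ (by omega) (by omega)]
      simp only [ramp]
      split_ifs <;> omega
  · rw [if_neg hx]
    by_cases hy : 1 ≤ y
    · rw [fan_of_lt hy (by omega)]
      by_cases hz : 1 ≤ S - x
      · rw [fan_of_lt hz (by omega)]
        simp only [tent', tent, ramp]
        split_ifs <;> omega
      · rw [fan_of_nonpos (by omega)]
        simp only [tent', tent, ramp]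
        split_ifs <;> omega
    · rw [fan_of_nonpos (y := y) (by omega)]
      by_cases hz : 1 ≤ S - x
      · rw [fan_of_lt hz (by omega)]
        simp only [tent', tent, ramp]
        split_ifs <;> omega
      · rw [fan_of_nonpos (by omega)]
        simp only [ramp]
        split_ifs <;> omega

/-- These coarse bounds suffice where no precise cancellation is needed. Positivity on boundary
edges absorbs the term `2 * k` in `abs_fan_fan_le`; positivity for `y ≤ 0` absorbs the step in
`abs_fan_step_le`. -/
theorem fan_bounds (hk : 1 ≤ k) (hS : 2 * k + 1 ≤ S) {x y : ℤ} (h1 : y < x) :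
    1 - k ≤ fan k S x y ∧ fan k S x y ≤ k ∧ (x = y + 1 ∨ y ≤ 0 → 1 ≤ fan k S x y) := by
  simp only [fan, tent', tent]
  split_ifs <;> omega

theorem abs_fan_fan_le (hk : 1 ≤ k) (hS : 2 * k + 1 ≤ S) {x y z w : ℤ} (h1 : y < x)
    (h : x - y = z - w) :
    |fan k S x y + fan k S z w - 2 * (if x = y + 1 then k else 0)| ≤ 2 * k := by
  have h1 := fan_bounds hk hS h1
  have h2 := fan_bounds hk hS (show w < z by omega)
  rw [abs_le]
  split_ifs <;> omega

theorem abs_fan_step_le (hk : 1 ≤ k) (hS : 2 * k + 1 ≤ S) {x y : ℤ} (h1 : y < x) :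
    |fan k S x y + step k x - step k y| ≤ 2 * k := by
  have h1 := fan_bounds hk hS h1
  rw [abs_le]
  simp only [step]
  split_ifs <;> omega

/-- For quadrilaterals `FE'E'F'`. The hypothesis `S ≤ y + z` expresses that the quadrilateral fits
in a half of the polygon. -/
theorem abs_ear_ear_le (hk : 1 ≤ k) (hS : 2 * k + 1 ≤ S) {x y z w : ℤ} (h1 : x < y)
    (h2 : y - x = w - z) (h3 : S ≤ y + z) :
    |step k y - step k x - step k z + step k w - ear k S x y - ear k S z w| ≤ 2 * k := by
  rw [abs_le]
  simp only [step]
  rcases lt_trichotomy x 1 with hx | rfl | hx <;> rcases lt_trichotomy z 1 with hz | rfl | hz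
  · rw [ear_of_nonpos (by omega), ear_of_nonpos (by omega)]
    simp only [tent', tent]
    split_ifs <;> omega
  · rw [ear_of_nonpos (by omega), ear_one]
    simp only [tent', tent]
    split_ifs <;> omega
  · rw [ear_of_nonpos (by omega), ear_of_two_le (by omega)]
    simp only [tent', tent]
    split_ifs <;> omega
  · rw [ear_one, ear_of_nonpos (by omega)]
    simp only [tent', tent]
    split_ifs <;> omega
  · rw [ear_one, ear_one]
    simp only [tent', tent]
    split_ifs <;> omega
  · rw [ear_one, ear_of_two_le (by omega)]
    simp only [tent', tent]
    split_ifs <;> omega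
  · rw [ear_of_two_le (by omega), ear_of_nonpos (by omega)]
    simp only [tent', tent]
    split_ifs <;> omega
  · rw [ear_of_two_le (by omega), ear_one]
    simp only [tent', tent]
    split_ifs <;> omega
  · rw [ear_of_two_le (by omega), ear_of_two_le (by omega)]
    simp only [tent]
    split_ifs <;> omega

/-- For central flips that exchange a diameter at a vertex of `E` with one at a vertex of `F`. -/
theorem abs_ramp_step_le (hk : 1 ≤ k) (hS : 2 * k + 1 ≤ S) (x : ℤ) :
    |ramp k x - ramp k (S - x) - step k (S - x) + step k x| ≤ 2 * k := by
  rw [abs_le]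
  simp only [step, ramp]
  split_ifs <;> omega

end Weight

/-! ### The weight of a triangle and its variation along flips -/

namespace Weight

/-- The weight of the triangle `(l, j, r)` when `0 ≤ l < 2 * n + S`. The vertices of the polygon are
split, up to the central symmetry, into those from `0` to `n` and the other ones. -/
def base (k S n l j r : ℤ) : ℤ :=
  let N := 2 * n + S
  if l ≤ n then
    if j ≤ n then
      if r ≤ n then 0
      else if r < N then ear k S (N - r - j) (N - r - l)
      else if r = l + N then -k else -(2 * k)
    else if j < N then
      if r < N then fan k S (N - j - l) (N - r - l) - if r = j + 1 then k else 0
      else if r = l + N then ramp k (N - j - l) - ramp k (S - (N - j - l)) else 0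
    else if r = l + N then k else 2 * k
  else
    if j < N then
      if r < N then (if j = l + 1 then k else 0) - if r = j + 1 then k else 0
      else if r ≤ N + n then
        (if j = l + 1 then k else 0) - fan k S (S - (N - j - (r - N))) (S - (N - l - (r - N)))
      else if j = l + 1 then k else 0
    else if j ≤ N + n then
      if r ≤ N + n then -ear k S (S - (N - l - (j - N))) (S - (N - l - (r - N)))
      else step k (S - (N - l - (j - N))) - step k (2 * N - r - (j - N))
    else -if r = j + 1 then k else 0

/-- The weight of the triangle `(l, j, r)`. -/
def weight (k S n l j r : ℤ) : ℤ :=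
  let t := l / (2 * n + S) * (2 * n + S)
  base k S n (l - t) (j - t) (r - t)

variable {k S n l j r : ℤ}

theorem weight_of_lt (h : 0 ≤ l) (h' : l < 2 * n + S) : weight k S n l j r = base k S n l j r := by
  simp only [weight, Int.ediv_eq_zero_of_lt h h', zero_mul, sub_zero]

theorem weight_add (hN : 0 < 2 * n + S) (l j r : ℤ) :
    weight k S n (l + (2 * n + S)) (j + (2 * n + S)) (r + (2 * n + S)) = weight k S n l j r := by
  have e : (l + (2 * n + S)) / (2 * n + S) = l / (2 * n + S) + 1 := by
    rw [Int.add_ediv_of_dvd_right dvd_rfl, Int.ediv_self hN.ne']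
  simp only [weight, e]
  congr 1 <;> ring

theorem weight_of_le (hN : 0 < 2 * n + S) (h : 2 * n + S ≤ l) (h' : l < 2 * (2 * n + S)) :
    weight k S n l j r = base k S n (l - (2 * n + S)) (j - (2 * n + S)) (r - (2 * n + S)) := by
  have := weight_add (k := k) hN (l - (2 * n + S)) (j - (2 * n + S)) (r - (2 * n + S))
  simp only [sub_add_cancel] at this
  rw [this, weight_of_lt (by omega) (by omega)]

section base

/-- The suffixes list the classes of `l`, `j`, `r`: `E` for `0, …, n`, `F` for the other vertices
below `2 * n + S`, with a prime for a translate by `2 * n + S`. The reflection `i ↦ n - i` preserves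
both classes, turns the coordinate `x` of an edge into `S - x`, and changes the sign of the weight.
-/
theorem base_EEE (h1 : l ≤ n) (h2 : j ≤ n) (h3 : r ≤ n) : base k S n l j r = 0 := by
  simp only [base]
  rw [if_pos h1, if_pos h2, if_pos h3]

theorem base_EEF (h1 : l ≤ n) (h2 : j ≤ n) (h3 : n < r) (h3' : r < 2 * n + S) :
    base k S n l j r = ear k S (2 * n + S - r - j) (2 * n + S - r - l) := by
  simp only [base]
  rw [if_pos h1, if_pos h2, if_neg (by omega), if_pos h3']

theorem base_EEE' (h1 : l ≤ n) (h2 : j ≤ n) (h3 : n < r) (h3' : 2 * n + S ≤ r) :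
    base k S n l j r = if r = l + (2 * n + S) then -k else -(2 * k) := by
  simp only [base]
  rw [if_pos h1, if_pos h2, if_neg (by omega), if_neg (by omega)]

theorem base_EFF (h1 : l ≤ n) (h2 : n < j) (h2' : j < r) (h3 : r < 2 * n + S) :
    base k S n l j r = fan k S (2 * n + S - j - l) (2 * n + S - r - l) -
      if r = j + 1 then k else 0 := by
  simp only [base]
  rw [if_pos h1, if_neg (by omega), if_pos (by omega), if_pos (by omega)]

theorem base_EFE' (h1 : l ≤ n) (h2 : n < j) (h2' : j < 2 * n + S) (h3 : 2 * n + S ≤ r) :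
    base k S n l j r = if r = l + (2 * n + S) then
      ramp k (2 * n + S - j - l) - ramp k (S - (2 * n + S - j - l)) else 0 := by
  simp only [base]
  rw [if_pos h1, if_neg (by omega), if_pos (by omega), if_neg (by omega)]

theorem base_EE'E' (h1 : l ≤ n) (h2 : n < j) (h2' : 2 * n + S ≤ j) :
    base k S n l j r = if r = l + (2 * n + S) then k else 2 * k := by
  simp only [base]
  rw [if_pos h1, if_neg (by omega), if_neg (by omega)]

theorem base_FFF (h1 : n < l) (h2 : j < r) (h3 : r < 2 * n + S) :
    base k S n l j r = (if j = l + 1 then k else 0) - if r = j + 1 then k else 0 := by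
  simp only [base]
  rw [if_neg (by omega), if_pos (by omega), if_pos (by omega)]

theorem base_FFE' (h1 : n < l) (h2 : j < 2 * n + S) (h3 : 2 * n + S ≤ r) (h3' : r ≤ 2 * n + S + n) :
    base k S n l j r = (if j = l + 1 then k else 0) - fan k S
      (S - (2 * n + S - j - (r - (2 * n + S)))) (S - (2 * n + S - l - (r - (2 * n + S)))) := by
  simp only [base]
  rw [if_neg (by omega), if_pos (by omega), if_neg (by omega), if_pos (by omega)]

theorem base_FFF' (h1 : n < l) (h2 : j < 2 * n + S) (h3 : 2 * n + S ≤ r) (h3' : 2 * n + S + n < r) :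
    base k S n l j r = if j = l + 1 then k else 0 := by
  simp only [base]
  rw [if_neg (by omega), if_pos (by omega), if_neg (by omega), if_neg (by omega)]

theorem base_FE'E' (h1 : n < l) (h2 : 2 * n + S ≤ j) (h3 : j < r) (h3' : r ≤ 2 * n + S + n) :
    base k S n l j r = -ear k S (S - (2 * n + S - l - (j - (2 * n + S))))
      (S - (2 * n + S - l - (r - (2 * n + S)))) := by
  simp only [base]
  rw [if_neg (by omega), if_neg (by omega), if_pos (by omega), if_pos (by omega)]

theorem base_FE'F' (h1 : n < l) (h2 : 2 * n + S ≤ j) (h2' : j ≤ 2 * n + S + n)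
    (h3 : 2 * n + S + n < r) :
    base k S n l j r = step k (S - (2 * n + S - l - (j - (2 * n + S)))) -
      step k (2 * (2 * n + S) - r - (j - (2 * n + S))) := by
  simp only [base]
  rw [if_neg (by omega), if_neg (by omega), if_pos (by omega), if_neg (by omega)]

theorem base_FF'F' (h1 : n < l) (h2 : 2 * n + S ≤ j) (h2' : 2 * n + S + n < j) :
    base k S n l j r = -if r = j + 1 then k else 0 := by
  simp only [base]
  rw [if_neg (by omega), if_neg (by omega), if_neg (by omega)]

end base

theorem ear_congr {x y x' y' : ℤ} (hx : x = x') (hy : y = y') : ear k S x y = ear k S x' y' := by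
  rw [hx, hy]

theorem fan_congr {x y x' y' : ℤ} (hx : x = x') (hy : y = y') : fan k S x y = fan k S x' y' := by
  rw [hx, hy]

/-- The classes of the four vertices select the inequality to apply. The case `e = a + (2 * n + S)`
is separate because triangles on a diameter have weights of their own. -/
theorem quad_of_left (hk : 1 ≤ k) (hS : 2 * k + 1 ≤ S) (hn : 0 ≤ n) {a b c e : ℤ} (h0 : 0 ≤ a)
    (han : a ≤ n) (h1 : a < b) (h2 : b < c) (h3 : c < e) (h4 : e ≤ a + (2 * n + S)) :
    |weight k S n a b c + weight k S n a c e - weight k S n a b e - weight k S n b c e| ≤ 2 * k := by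
  have hN : 0 < 2 * n + S := by omega
  rw [weight_of_lt h0 (by omega), weight_of_lt h0 (by omega), weight_of_lt h0 (by omega)]
  by_cases hb : b < 2 * n + S
  swap
  · rw [weight_of_le hN (by omega) (by omega), base_EE'E' han (by omega) (by omega),
      base_EE'E' han (by omega) (by omega), base_EE'E' han (by omega) (by omega),
      base_EEE (by omega) (by omega) (by omega), abs_le]
    split_ifs <;> omega
  rw [weight_of_lt (l := b) (by omega) hb]
  by_cases hbn : b ≤ n
  · by_cases hcn : c ≤ n
    · by_cases hen : e ≤ n
      · rw [base_EEE, base_EEE, base_EEE, base_EEE, abs_le] <;> omega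
      by_cases heN : e < 2 * n + S
      · have := abs_ear_le hk hS (show 2 * n + S - e - c < 2 * n + S - e - b by omega)
          (show _ < 2 * n + S - e - a by omega)
        rw [base_EEE han hbn hcn, base_EEF han hcn (by omega) heN, base_EEF han hbn (by omega) heN,
          base_EEF hbn hcn (by omega) heN, zero_add]
        exact this
      · rw [base_EEE han hbn hcn, base_EEE' han hcn (by omega) (by omega),
          base_EEE' han hbn (by omega) (by omega), base_EEE' hbn hcn (by omega) (by omega), abs_le]
        split_ifs <;> omega
    by_cases hcN : c < 2 * n + S
    · by_cases heN : e < 2 * n + S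
      · have := abs_ear_fan_le hk hS (x := 2 * n + S - c - b) (y := 2 * n + S - e - b) (h := b - a)
          (by omega) (by omega)
        rw [base_EEF han hbn (by omega) (by omega), base_EFF han (by omega) h3 heN,
          base_EEF han hbn (by omega) heN, base_EFF hbn (by omega) h3 heN]
        convert this using 2
        rw [show 2 * n + S - c - a = 2 * n + S - c - b + (b - a) by ring,
          show 2 * n + S - e - a = 2 * n + S - e - b + (b - a) by ring]
        ring
      · rw [base_EEF han hbn (by omega) (by omega), base_EFE' han (by omega) hcN (by omega),
          base_EEE' han hbn (by omega) (by omega), base_EFE' hbn (by omega) hcN (by omega),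
          if_neg (c := e = b + _) (by omega)]
        split_ifs
        · convert abs_ear_ramp_le hk hS (show 2 * n + S - c - b < 2 * n + S - c - a by omega) using 2
          ring
        · convert abs_ear_add_le (S := S) hk (2 * n + S - c - b) (2 * n + S - c - a) using 2
          ring
    · rw [base_EEE' han hbn (by omega) (by omega), base_EE'E' han (by omega) (by omega),
          base_EEE' han hbn (by omega) (by omega), base_EE'E' hbn (by omega) (by omega), abs_le]
      split_ifs <;> omega
  by_cases hcN : c < 2 * n + S
  · by_cases heN : e < 2 * n + S
    · have := abs_fan_le hk hS (show 2 * n + S - c - a < 2 * n + S - b - a by omega)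
        (show 2 * n + S - e - a < _ by omega)
      rw [base_EFF han (by omega) h2 hcN, base_EFF han (by omega) h3 heN,
        base_EFF han (by omega) (by omega) heN, base_FFF (by omega) h3 heN,
        if_neg (c := e = b + 1) (by omega), if_congr (P := c = b + 1)
        (Q := 2 * n + S - b - a = 2 * n + S - c - a + 1) (by omega) rfl rfl]
      convert this using 2
      ring
    · rw [base_EFF han (by omega) h2 hcN, base_EFE' han (by omega) hcN (by omega),
        base_EFE' han (by omega) hb (by omega), base_FFE' (by omega) hcN (by omega) (by omega),
        if_congr (P := c = b + 1) (Q := 2 * n + S - b - a = 2 * n + S - c - a + 1) (by omega) rfl rfl]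
      by_cases he : e = a + (2 * n + S)
      · subst he
        convert abs_fan_ramp_le hk hS (show 2 * n + S - c - a < 2 * n + S - b - a by omega) using 2
        rw [if_pos rfl, if_pos rfl, add_sub_cancel_right]
        ring
      · convert abs_fan_fan_le hk hS (show 2 * n + S - c - a < 2 * n + S - b - a by omega)
          (show _ = (S - (2 * n + S - c - (e - (2 * n + S)))) -
            (S - (2 * n + S - b - (e - (2 * n + S)))) by ring) using 2
        rw [if_neg he, if_neg he]
        ring
  · rw [base_EFE' han (by omega) hb (by omega), base_EE'E' han (by omega) (by omega),
      base_EFE' han (by omega) hb (by omega), base_FE'E' (by omega) (by omega) h3 (by omega),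
      if_neg (c := c = a + _) (by omega)]
    by_cases he : e = a + (2 * n + S)
    · subst he
      rw [if_pos rfl, if_pos rfl, abs_sub_comm]
      rw [add_sub_cancel_right]
      have := abs_ear_ramp_le hk hS (show S - (2 * n + S - b - (c - (2 * n + S))) <
        S - (2 * n + S - b - a) by omega)
      rw [abs_le] at this ⊢
      rw [sub_sub_cancel] at this
      omega
    · rw [if_neg he, if_neg he]
      convert abs_ear_add_le (S := S) hk (S - (2 * n + S - b - (c - (2 * n + S))))
        (S - (2 * n + S - b - (e - (2 * n + S)))) using 2
      ring

/-- Up to sign and reflection, many cases reduce to the inequalities of `quad_of_left`. The types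
`FFE'F'`, `FE'E'F'` and `FE'F'F'` involve `step`. -/
theorem quad_of_right (hk : 1 ≤ k) (hS : 2 * k + 1 ≤ S) (hn : 0 ≤ n) {a b c e : ℤ} (han : n < a)
    (h0 : a < 2 * n + S) (h1 : a < b) (h2 : b < c) (h3 : c < e) (h4 : e ≤ a + (2 * n + S)) :
    |weight k S n a b c + weight k S n a c e - weight k S n a b e - weight k S n b c e| ≤ 2 * k := by
  have hN : 0 < 2 * n + S := by omega
  rw [weight_of_lt (by omega) h0, weight_of_lt (by omega) h0, weight_of_lt (by omega) h0]
  by_cases hb : b < 2 * n + S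
  · rw [weight_of_lt (l := b) (by omega) hb]
    by_cases hc : c < 2 * n + S
    · by_cases he : e < 2 * n + S
      · rw [base_FFF han h2 hc, base_FFF han h3 he, base_FFF han (by omega) he,
          base_FFF (by omega) h3 he, abs_le]
        split_ifs <;> omega
      by_cases hen : e ≤ 2 * n + S + n
      · rw [base_FFF han h2 hc, base_FFE' han hc (by omega) hen, base_FFE' han hb (by omega) hen,
          base_FFE' (by omega) hc (by omega) hen, if_neg (c := c = a + 1) (by omega), abs_sub_comm,
          if_congr (P := c = b + 1) (Q := S - (2 * n + S - c - (e - (2 * n + S))) =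
            S - (2 * n + S - b - (e - (2 * n + S))) + 1) (by omega) rfl rfl]
        have := abs_fan_le hk hS (show S - (2 * n + S - b - (e - (2 * n + S))) <
          S - (2 * n + S - c - (e - (2 * n + S))) by omega)
          (show S - (2 * n + S - a - (e - (2 * n + S))) < _ by omega)
        rw [abs_le] at this ⊢
        split_ifs at this ⊢ <;> omega
      · rw [base_FFF han h2 hc, base_FFF' han hc (by omega) (by omega),
          base_FFF' han hb (by omega) (by omega), base_FFF' (by omega) hc (by omega) (by omega), abs_le]
        split_ifs <;> omega
    · by_cases hcn : c ≤ 2 * n + S + n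
      · by_cases hen : e ≤ 2 * n + S + n
        · rw [base_FFE' han hb (by omega) hcn, base_FE'E' han (by omega) h3 hen,
            base_FFE' han hb (by omega) hen, base_FE'E' (by omega) (by omega) h3 hen]
          have := abs_ear_fan_le hk hS (x := S - (2 * n + S - b - (c - (2 * n + S))))
            (y := S - (2 * n + S - a - (c - (2 * n + S)))) (h := e - c) (by omega) (by omega)
          rw [show S - (2 * n + S - a - (e - (2 * n + S))) =
              S - (2 * n + S - a - (c - (2 * n + S))) + (e - c) by ring,
            show S - (2 * n + S - b - (e - (2 * n + S))) =
              S - (2 * n + S - b - (c - (2 * n + S))) + (e - c) by ring]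
          convert this using 2
          ring
        · rw [base_FFE' han hb (by omega) hcn, base_FE'F' han (by omega) hcn (by omega),
            base_FFF' han hb (by omega) (by omega), base_FE'F' (by omega) (by omega) hcn (by omega),
            abs_sub_comm]
          convert abs_fan_step_le hk hS (show S - (2 * n + S - a - (c - (2 * n + S))) <
            S - (2 * n + S - b - (c - (2 * n + S))) by omega) using 2
          ring
      · rw [base_FFF' han hb (by omega) (by omega), base_FF'F' han (by omega) (by omega),
          base_FFF' han hb (by omega) (by omega), base_FF'F' (by omega) (by omega) (by omega), abs_le]
        split_ifs <;> omega
  · rw [weight_of_le hN (by omega) (by omega)]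
    by_cases hbn : b ≤ 2 * n + S + n
    · by_cases hcn : c ≤ 2 * n + S + n
      · by_cases hen : e ≤ 2 * n + S + n
        · rw [base_FE'E' han (by omega) h2 hcn, base_FE'E' han (by omega) h3 hen,
            base_FE'E' han (by omega) (by omega) hen, base_EEE (by omega) (by omega) (by omega)]
          convert abs_ear_le hk hS (show S - (2 * n + S - a - (b - (2 * n + S))) <
            S - (2 * n + S - a - (c - (2 * n + S))) by omega)
            (show _ < S - (2 * n + S - a - (e - (2 * n + S))) by omega) using 2
          ring
        · rw [base_FE'E' han (by omega) h2 hcn, base_FE'F' han (by omega) hcn (by omega),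
            base_FE'F' han (by omega) hbn (by omega),
            base_EEF (by omega) (by omega) (by omega) (by omega)]
          have := abs_ear_ear_le hk hS (x := S - (2 * n + S - a - (b - (2 * n + S))))
            (y := S - (2 * n + S - a - (c - (2 * n + S))))
            (z := 2 * (2 * n + S) - e - (c - (2 * n + S)))
            (w := 2 * (2 * n + S) - e - (b - (2 * n + S))) (by omega) (by omega) (by omega)
          rw [show 2 * n + S - (e - (2 * n + S)) - (c - (2 * n + S)) =
              2 * (2 * n + S) - e - (c - (2 * n + S)) by ring,
            show 2 * n + S - (e - (2 * n + S)) - (b - (2 * n + S)) =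
              2 * (2 * n + S) - e - (b - (2 * n + S)) by ring]
          convert this using 2
          ring
      · rw [base_FE'F' han (by omega) hbn (by omega), base_FF'F' han (by omega) (by omega),
          base_FE'F' han (by omega) hbn (by omega), base_EFF (by omega) (by omega) (by omega) (by omega),
          if_congr (P := e - (2 * n + S) = c - (2 * n + S) + 1) (Q := e = c + 1) (by omega) rfl rfl,
          abs_sub_comm]
        convert abs_fan_step_le hk hS
          (show 2 * n + S - (e - (2 * n + S)) - (b - (2 * n + S)) <
            2 * n + S - (c - (2 * n + S)) - (b - (2 * n + S)) by omega) using 2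
        rw [show 2 * n + S - (e - (2 * n + S)) - (b - (2 * n + S)) =
              2 * (2 * n + S) - e - (b - (2 * n + S)) by ring,
            show 2 * n + S - (c - (2 * n + S)) - (b - (2 * n + S)) =
              2 * (2 * n + S) - c - (b - (2 * n + S)) by ring]
        ring
    · rw [base_FF'F' han (by omega) (by omega), base_FF'F' han (by omega) (by omega),
        base_FF'F' han (by omega) (by omega), base_FFF (by omega) (by omega) (by omega), abs_le]
      split_ifs <;> omega

theorem central_of_lt (hk : 1 ≤ k) (hS : 2 * k + 1 ≤ S) (hn : 0 ≤ n) {a b : ℤ} (h0 : 0 ≤ a)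
    (ha : a < 2 * n + S) (h1 : a < b) (h2 : b < a + (2 * n + S)) :
    |weight k S n a b (a + (2 * n + S)) - weight k S n b (a + (2 * n + S)) (b + (2 * n + S))| ≤
      2 * k := by
  have hN : 0 < 2 * n + S := by omega
  rw [weight_of_lt h0 ha]
  by_cases han : a ≤ n
  · by_cases hb : b < 2 * n + S
    · rw [weight_of_lt (l := b) (by omega) hb]
      by_cases hbn : b ≤ n
      · rw [base_EEE' han hbn (by omega) (by omega), base_EE'E' hbn (by omega) (by omega), if_pos rfl,
          if_pos rfl, abs_le]
        omega
      · rw [base_EFE' han (by omega) hb (by omega), if_pos rfl,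
          base_FE'F' (by omega) (by omega) (by omega) (by omega), add_sub_cancel_right,
          show 2 * (2 * n + S) - (b + (2 * n + S)) - a = 2 * n + S - b - a by ring, sub_sub_eq_add_sub,
          add_sub_right_comm]
        exact abs_ramp_step_le hk hS _
    · rw [weight_of_le hN (by omega) (by omega), base_EE'E' han (by omega) (by omega), if_pos rfl,
        base_EEE' (by omega) (by omega) (by omega) (by omega), if_pos (by omega), abs_le]
      omega
  · by_cases hb : b < 2 * n + S
    · rw [weight_of_lt (l := b) (by omega) hb, base_FFF' (by omega) hb (by omega) (by omega),
        base_FF'F' (by omega) (by omega) (by omega), abs_le]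
      split_ifs <;> omega
    · rw [weight_of_le hN (by omega) (by omega)]
      by_cases hbn : b ≤ 2 * n + S + n
      · rw [base_FE'F' (by omega) (by omega) hbn (by omega),
          base_EFE' (by omega) (by omega) (by omega) (by omega), if_pos (by omega), abs_sub_comm]
        convert abs_ramp_step_le hk hS (2 * n + S - a - (b - (2 * n + S))) using 2
        rw [add_sub_cancel_right, show 2 * (2 * n + S) - (a + (2 * n + S)) - (b - (2 * n + S)) =
          2 * n + S - a - (b - (2 * n + S)) by ring]
        ring
      · rw [base_FF'F' (by omega) (by omega) (by omega),
          base_FFF' (by omega) (by omega) (by omega) (by omega), abs_le]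
        split_ifs <;> omega

theorem weight_add_mul (hN : 0 < 2 * n + S) (l j r s : ℤ) :
    weight k S n (l + s * (2 * n + S)) (j + s * (2 * n + S)) (r + s * (2 * n + S)) =
      weight k S n l j r := by
  induction s using Int.induction_on with
  | zero => simp
  | succ i ih =>
    rw [← ih, ← weight_add hN (l + i * (2 * n + S))]
    congr 1 <;> ring
  | pred i ih =>
    rw [← ih, ← weight_add hN (l + (-i - 1) * (2 * n + S))]
    congr 1 <;> ring

theorem flipBounded_weight {d : ℕ} (hk : 1 ≤ k) (hS : 2 * k + 1 ≤ S) (hn : 0 ≤ n)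
    (hd : (d : ℤ) + 1 = 2 * n + S) : CSTriangulation.FlipBounded d (weight k S n) (2 * k) := by
  have hN : 0 < 2 * n + S := by omega
  refine ⟨fun l j r ↦ ?_, fun a b c e h1 h2 h3 h4 ↦ ?_, fun a b h1 h2 ↦ ?_⟩
  · rw [hd, weight_add hN]
  · obtain ⟨s, hs, hs'⟩ := exists_mul_le (d := d) 0 a
    rw [hd] at *
    rw [← weight_add_mul hN a b c s, ← weight_add_mul hN a c e s, ← weight_add_mul hN a b e s,
      ← weight_add_mul hN b c e s]
    by_cases han : a + s * (2 * n + S) ≤ n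
    · exact quad_of_left hk hS hn hs han (by omega) (by omega) (by omega) (by omega)
    · exact quad_of_right hk hS hn (by omega) (by omega) (by omega) (by omega) (by omega) (by omega)
  · obtain ⟨s, hs, hs'⟩ := exists_mul_le (d := d) 0 a
    rw [hd] at *
    rw [← weight_add_mul hN a b _ s, ← weight_add_mul hN b _ _ s, add_right_comm a,
      add_right_comm b (2 * n + S)]
    exact central_of_lt hk hS hn hs (by omega) (by omega) (by omega)

end Weight

/-! ### The potential of a triangulation built from a tree -/

namespace Tree

/-- The triangles of the triangulation encoded by a tree. -/
def tris : Tree → ℤ → Finset (ℤ × ℤ × ℤ)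
  | leaf, _ => ∅
  | node l r, i =>
    insert (i, i + l.size, i + (l.size + r.size)) (l.tris i ∪ r.tris (i + l.size))

theorem bounds_of_mem_tris : ∀ {t : Tree} {i x y z : ℤ}, (x, y, z) ∈ t.tris i →
    i ≤ x ∧ x < y ∧ y < z ∧ z ≤ i + t.size ∧ t.Arc i x y ∧ t.Arc i y z ∧ t.Arc i x z
  | leaf, _, _, _, _, h => by simp [tris] at h
  | node l r, i, x, y, z, h => by
    have h1 := l.size_pos
    have h2 := r.size_pos
    simp only [tris, Finset.mem_insert, Finset.mem_union, Prod.mk.injEq] at h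
    simp only [size]
    rcases h with ⟨rfl, rfl, rfl⟩ | h | h
    · exact ⟨le_rfl, by omega, by omega, le_rfl, Or.inr (Or.inl (l.arc_root _)),
        Or.inr (Or.inr (r.arc_root' (by omega))), Or.inl ⟨rfl, rfl⟩⟩
    · obtain ⟨k1, k2, k3, k4, k5, k6, k7⟩ := bounds_of_mem_tris h
      exact ⟨k1, k2, k3, by omega, Or.inr (Or.inl k5), Or.inr (Or.inl k6), Or.inr (Or.inl k7)⟩
    · obtain ⟨k1, k2, k3, k4, k5, k6, k7⟩ := bounds_of_mem_tris h
      exact ⟨by omega, k2, k3, by omega, Or.inr (Or.inr k5), Or.inr (Or.inr k6), Or.inr (Or.inr k7)⟩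

theorem mem_tris_of_arc : ∀ {t : Tree} {i x y z : ℤ}, t.Arc i x y → t.Arc i y z → t.Arc i x z →
    (x, y, z) ∈ t.tris i
  | leaf, _, _, _, _, h1, h2, h3 => by simp only [Arc] at *; omega
  | node l r, i, x, y, z, h1, h2, h3 => by
    have e1 := l.size_pos
    have e2 := r.size_pos
    have b1 := h1.bounds
    have b2 := h2.bounds
    simp only [size] at b1 b2
    simp only [tris, Finset.mem_insert, Finset.mem_union, Prod.mk.injEq]
    rcases h3 with h3 | h3 | h3
    · left
      rcases h1 with h1 | h1 | h1
      · omega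
      · rcases h2 with h2 | h2 | h2
        · omega
        · have := h1.bounds; have := h2.bounds; omega
        · have := h1.bounds; have := h2.bounds; omega
      · have := h1.bounds; omega
    · have := h3.bounds
      rcases h1 with h1 | h1 | h1
      · omega
      · rcases h2 with h2 | h2 | h2
        · omega
        · exact Or.inr (Or.inl (mem_tris_of_arc h1 h2 h3))
        · have := h2.bounds; omega
      · have := h1.bounds; omega
    · have := h3.bounds
      rcases h1 with h1 | h1 | h1
      · omega
      · have := h1.bounds; omega
      · rcases h2 with h2 | h2 | h2
        · omega
        · have := h2.bounds; omega
        · exact Or.inr (Or.inr (mem_tris_of_arc h1 h2 h3))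

/-- The sum of a function over the triangles of the triangulation encoded by a tree. -/
def sum (φ : ℤ → ℤ → ℤ → ℤ) : Tree → ℤ → ℤ
  | leaf, _ => 0
  | node l r, i => φ i (i + l.size) (i + (l.size + r.size)) + (l.sum φ i + r.sum φ (i + l.size))

theorem sum_tris (φ : ℤ → ℤ → ℤ → ℤ) : ∀ (t : Tree) (i : ℤ),
    ∑ p ∈ t.tris i, φ p.1 p.2.1 p.2.2 = t.sum φ i
  | leaf, _ => rfl
  | node l r, i => by
    have h1 := l.size_pos
    have h2 := r.size_pos
    rw [tris, sum, Finset.sum_insert, Finset.sum_union, sum_tris φ l, sum_tris φ r]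
    · rw [Finset.disjoint_left]
      rintro ⟨x, y, z⟩ h h'
      have := bounds_of_mem_tris h
      have := bounds_of_mem_tris h'
      omega
    · rw [Finset.mem_union]
      rintro (h | h)
      · have := bounds_of_mem_tris h; omega
      · have := bounds_of_mem_tris h; omega

end Tree

namespace CSTriangulation

theorem side_ofTree_iff {c : ℤ} {t : Tree} (ht : t.size = d + 1) {x y : ℤ} (h1 : x < y)
    (h2 : y ≤ x + (d + 1)) :
    (ofTree c t ht).Side x y ↔ ∃ s : ℤ, t.Arc c (x + s * (d + 1)) (y + s * (d + 1)) :=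
  mem_chords_iff (fun x y h ↦ by have := h.bounds; omega) h1 h2

theorem eq_of_mem_window {c x s t : ℤ} (h1 : c ≤ x + s * (d + 1)) (h2 : x + s * (d + 1) < c + (d + 1))
    (h3 : c ≤ x + t * (d + 1)) (h4 : x + t * (d + 1) < c + (d + 1)) : s = t := by
  have k1 : s - t < 1 := by by_contra!; nlinarith
  have k2 : -1 < s - t := by by_contra!; nlinarith
  omega

theorem isTri_ofTree_iff {c : ℤ} {t : Tree} (ht : t.size = d + 1) {l j r : ℤ} :
    (ofTree c t ht).IsTri l j r ↔
      ∃ s : ℤ, (l + s * (d + 1), j + s * (d + 1), r + s * (d + 1)) ∈ t.tris c := by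
  constructor
  · rintro ⟨h1, h2, h3, s1, s2, s3⟩
    obtain ⟨s, hs⟩ := (side_ofTree_iff ht h1 (by omega)).1 s1
    obtain ⟨u, hu⟩ := (side_ofTree_iff ht h2 (by omega)).1 s2
    obtain ⟨w, hw⟩ := (side_ofTree_iff ht (by omega) h3).1 s3
    have b1 := hs.bounds
    have b2 := hu.bounds
    have b3 := hw.bounds
    rw [ht] at b1 b2 b3
    -- The three sides are lifted separately. The common left end identifies two of the
    -- translations; the common right end, which lies in the window starting at `c + 1`, identifies
    -- the third.
    obtain rfl : s = w := eq_of_mem_window (d := d) (c := c) (x := l)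
      (by omega) (by omega) (by omega) (by omega)
    obtain rfl : s = u := eq_of_mem_window (d := d) (c := c + 1) (x := r)
      (by omega) (by omega) (by omega) (by omega)
    exact ⟨s, Tree.mem_tris_of_arc hs hu hw⟩
  · rintro ⟨s, hs⟩
    obtain ⟨k1, k2, k3, k4, k5, k6, k7⟩ := Tree.bounds_of_mem_tris hs
    exact (isTri_add_iff s).1 ⟨k2, k3, by omega, mem_chords_of k5, mem_chords_of k6, mem_chords_of k7⟩

theorem potential_ofTree {φ : ℤ → ℤ → ℤ → ℤ} {D : ℤ} (hφ : FlipBounded d φ D) (c : ℤ) {t : Tree}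
    (ht : t.size = d + 1) : potential φ (ofTree c t ht) = t.sum φ c := by
  rw [← Tree.sum_tris, potential]
  symm
  refine Finset.sum_nbij (fun p ↦ reduce d p.1 p.2.1 p.2.2) ?_ ?_ ?_ ?_
  · rintro ⟨l, j, r⟩ h
    rw [reduce_mem_tri, isTri_ofTree_iff]
    exact ⟨0, by simpa using h⟩
  · rintro ⟨l, j, r⟩ h ⟨l', j', r'⟩ h' he
    have b1 := Tree.bounds_of_mem_tris h
    have b2 := Tree.bounds_of_mem_tris h'
    simp only [reduce, Prod.mk.injEq] at he
    rw [ht] at b1 b2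
    have e : l = l' + (-(l' / (d + 1)) + l / (d + 1)) * (d + 1) := by linarith [he.1]
    have : (0 : ℤ) = -(l' / (d + 1)) + l / (d + 1) :=
      eq_of_mem_window (d := d) (c := c) (x := l') (by omega) (by omega) (by omega) (by omega)
    obtain ⟨k1, k2, k3⟩ := he
    rw [show l / ((d : ℤ) + 1) = l' / (d + 1) by omega] at k1 k2 k3
    simp only [Prod.mk.injEq]
    exact ⟨by linarith, by linarith, by linarith⟩
  · rintro ⟨l, j, r⟩ h
    obtain ⟨h1, h2, h3⟩ := mem_tri.1 h
    obtain ⟨s, hs⟩ := (isTri_ofTree_iff ht).1 h3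
    refine ⟨_, hs, ?_⟩
    have e : ∀ x : ℤ, x = x + s * (d + 1) + -s * (d + 1) := fun x ↦ by ring
    conv_rhs => rw [e l, e j, e r]
    exact (reduce_eq (by rwa [← e]) (by rwa [← e])).symm
  · rintro ⟨l, j, r⟩ -
    exact (hφ.reduce l j r).symm

end CSTriangulation

/-! ### The two extremal triangulations and their potentials -/

namespace Tree

/-- The tree all of whose right children are leaves. -/
def leftComb : ℕ → Tree
  | 0 => leaf
  | s + 1 => node (leftComb s) leaf

theorem leftComb_size (s : ℕ) : (leftComb s).size = s + 1 := by
  induction s with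
  | zero => rfl
  | succ n ih => simp only [leftComb, size, ih]; push_cast; ring

/-- A zigzag followed by a comb. -/
def zigzag (s : ℕ) : ℕ → Tree
  | 0 => leftComb s
  | n + 1 => node (node leaf (zigzag s n)) leaf

theorem zigzag_size (s n : ℕ) : (zigzag s n).size = 2 * n + (s + 1) := by
  induction n with
  | zero => simp [zigzag, leftComb_size]
  | succ n ih => simp only [zigzag, size, ih]; push_cast; ring

/-- The mirror image of `zigzag`. -/
def zagzig (s : ℕ) : ℕ → Tree
  | 0 => comb s
  | n + 1 => node leaf (node (zagzig s n) leaf)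

theorem zagzig_size (s n : ℕ) : (zagzig s n).size = 2 * n + (s + 1) := by
  induction n with
  | zero => simp [zagzig, comb_size]
  | succ n ih => simp only [zagzig, size, ih]; push_cast; ring

end Tree

namespace Weight

open Cyclohedron.Tree

variable {k S n : ℤ}

theorem ear_zero_one (hk : 1 ≤ k) (hS : 2 * k + 1 ≤ S) : ear k S 0 1 = 1 - 4 * k := by
  simp only [ear, tent', tent]
  split_ifs <;> omega

theorem fan_succ_eq_one (hk : 1 ≤ k) {x : ℤ} (h1 : 0 ≤ x) (h2 : x + 1 < S) :
    fan k S (x + 1) x = 1 := by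
  rcases h1.eq_or_lt with rfl | h1
  · rw [fan_of_nonpos le_rfl]; omega
  · rw [fan_succ h1 rfl, if_neg h2.ne]

theorem sum_leftComb (hk : 1 ≤ k) (hn : 1 ≤ n) (s : ℕ) (hs : s + 1 ≤ S) :
    (leftComb s).sum (weight k S n) n = s * (1 - k) := by
  induction s with
  | zero => simp [leftComb, Tree.sum]
  | succ s ih =>
    push_cast at hs
    rw [leftComb, Tree.sum, ih (by omega)]
    simp only [Tree.sum, leftComb_size, size]
    rw [weight_of_lt (by omega) (by omega), base_EFF (by omega) (by omega) (by omega) (by omega),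
      if_pos (by ring), show 2 * n + S - (n + (s + 1)) - n = 2 * n + S - (n + (s + 1 + 1)) - n + 1 by
        ring, fan_succ_eq_one hk (by omega) (by omega)]
    push_cast; ring

/-- All zigzag edges have coordinate 0 or 1. A level consists of a triangle of weight `ear k S 0 1 =
1 - 4 * k` and one on a boundary edge of weight `1 - k`. The final fan, at the vertex `n`, has `s`
triangles of weight `1 - k`. -/
theorem sum_zigzag (hk : 1 ≤ k) {s : ℕ} (hS : 2 * k + 1 ≤ s + 1) (hn : 1 ≤ n) (m : ℕ) {i : ℤ}
    (hi : 1 ≤ i) (him : i + m = n) :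
    (zigzag s m).sum (weight k (s + 1) n) i = m * (2 - 5 * k) + s * (1 - k) := by
  induction m generalizing i with
  | zero =>
    obtain rfl : i = n := by simpa using him
    rw [zigzag, sum_leftComb hk hn s le_rfl]
    push_cast; ring
  | succ m ih =>
    push_cast at him
    simp only [zigzag, Tree.sum, zigzag_size, size]
    rw [ih (i := i + 1) (by omega) (by omega)]
    rw [weight_of_lt (by omega) (by omega), weight_of_lt (by omega) (by omega),
      base_EFF (by omega) (by omega) (by omega) (by omega),
      base_EEF (by omega) (by omega) (by omega) (by omega), if_pos (by ring),
      fan_of_nonpos (by omega), ear_congr (x' := 0) (y' := 1) (by omega) (by omega),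
      ear_zero_one hk hS]
    rw [min_eq_left (by omega)]
    push_cast; linarith

theorem sum_zigzag_zero (hk : 1 ≤ k) {s : ℕ} (hS : 2 * k + 1 ≤ s + 1) (m : ℕ) :
    (zigzag s (m + 1)).sum (weight k (s + 1) (m + 1)) 0 =
      -((m + 1) * (5 * k - 2) + (s - 2) * (k - 1)) := by
  simp only [zigzag, Tree.sum, zigzag_size, size]
  rw [zero_add, sum_zigzag hk hS (by omega) m (by omega) (by omega)]
  rw [weight_of_lt (by omega) (by omega), weight_of_lt (by omega) (by omega),
    base_EFE' (by omega) (by omega) (by omega) (by omega),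
    base_EEF (by omega) (by omega) (by omega) (by omega), if_pos (by ring),
    ear_congr (x' := 0) (y' := 1) (by omega) (by omega), ear_zero_one hk hS]
  -- The triangle on the diameter weighs `k - 1` instead of `1 - k`, which is why `s - 2` appears in
  -- place of `s`.
  simp only [ramp]
  rw [if_pos (by omega), if_pos (by omega), max_eq_right (by omega), max_eq_left (by omega)]
  linarith

theorem sum_comb (hk : 1 ≤ k) (hn : 1 ≤ n) (s : ℕ) (hs : s + 1 ≤ S) :
    (comb s).sum (weight k S n) (2 * n + S - (s + 1)) = s * (k - 1) := by
  induction s with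
  | zero => simp [comb, Tree.sum]
  | succ s ih =>
    push_cast at hs
    rw [comb, Tree.sum, size, show 2 * n + S - ((s + 1 : ℕ) + 1) + 1 = 2 * n + S - (s + 1) by
      push_cast; ring, ih (by omega)]
    simp only [Tree.sum, comb_size]
    push_cast
    rw [weight_of_lt (by omega) (by omega), base_FFE' (by omega) (by omega) (by omega) (by omega),
      if_pos (by ring)]
    have := fan_succ_eq_one (S := S) hk (x := S - (s + 2)) (by omega) (by omega)
    rw [fan_congr (x' := S - (s + 2) + 1) (y' := S - (s + 2)) (by ring) (by ring), this]
    ring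

/-- The mirror image of `sum_zigzag`: the edges now join `F` to `E'`, and every weight changes sign.
-/
theorem sum_zagzig (hk : 1 ≤ k) {s : ℕ} (hS : 2 * k + 1 ≤ s + 1) (hn : 1 ≤ n) (m : ℕ) {i : ℤ}
    (hi : n + 1 ≤ i) (him : i + m = 2 * n) :
    (zagzig s m).sum (weight k (s + 1) n) i = m * (5 * k - 2) + s * (k - 1) := by
  induction m generalizing i with
  | zero =>
    obtain rfl : i = 2 * n + (s + 1 : ℤ) - (s + 1) := by push_cast at him; omega
    rw [zagzig, sum_comb hk hn s le_rfl]
    push_cast; ring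
  | succ m ih =>
    push_cast at him
    simp only [zagzig, Tree.sum, zagzig_size, size]
    rw [ih (i := i + 1) (by omega) (by omega)]
    rw [weight_of_lt (by omega) (by omega), weight_of_lt (by omega) (by omega),
      base_FFE' (by omega) (by omega) (by omega) (by omega),
      base_FE'E' (by omega) (by omega) (by omega) (by omega), if_pos (by ring),
      fan_of_nonpos (by omega), ear_congr (x' := 0) (y' := 1) (by omega) (by omega),
      ear_zero_one hk hS]
    rw [min_eq_left (by omega)]
    push_cast; linarith

theorem sum_zagzig_zero (hk : 1 ≤ k) {s : ℕ} (hS : 2 * k + 1 ≤ s + 1) (m : ℕ) :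
    (zagzig s (m + 1)).sum (weight k (s + 1) (m + 1)) (m + 1) =
      (m + 1) * (5 * k - 2) + (s - 2) * (k - 1) := by
  simp only [zagzig, Tree.sum, zagzig_size, size]
  rw [sum_zagzig hk hS (by omega) m (by omega) (by omega)]
  rw [weight_of_lt (by omega) (by omega), weight_of_lt (by omega) (by omega),
    base_EFE' (by omega) (by omega) (by omega) (by omega),
    base_FE'E' (by omega) (by omega) (by omega) (by omega), if_pos (by ring),
    ear_congr (x' := 0) (y' := 1) (by omega) (by omega), ear_zero_one hk hS]
  simp only [ramp]
  rw [if_pos (by omega), if_pos (by omega), max_eq_left (by omega), max_eq_right (by omega)]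
  linarith

end Weight

/-! ### The distance bound and the choice of `k` -/

/-- Two centrally symmetric triangulations whose distance is bounded below. -/
theorem exists_dist_ge {k : ℤ} (hk : 1 ≤ k) {s m : ℕ} (hS : 2 * k + 1 ≤ s + 1)
    (hd : d = 2 * (m + 1) + s) : ∃ T T' : CSTriangulation d,
      (m + 1) * (5 * k - 2) + (s - 2) * (k - 1) ≤ k * (flipGraph d).dist T T' := by
  have hd' : (d : ℤ) + 1 = 2 * (m + 1) + (s + 1) := by rw [hd]; push_cast; ring
  have h1 : (Tree.zigzag s (m + 1)).size = d + 1 := by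
    rw [Tree.zigzag_size, hd']; push_cast; ring
  have h2 : (Tree.zagzig s (m + 1)).size = d + 1 := by
    rw [Tree.zagzig_size, hd']; push_cast; ring
  have hφ := Weight.flipBounded_weight hk hS (by omega : (0 : ℤ) ≤ m + 1) hd'
  have hr := CSTriangulation.reachable_ofTree (by omega) 0 (m + 1) h1 h2
  rw [zero_add, Nat.cast_succ] at hr
  refine ⟨.ofTree 0 _ h1, .ofTree (m + 1) _ h2, ?_⟩
  have := CSTriangulation.abs_potential_sub_le_dist hφ hr
  rw [CSTriangulation.potential_ofTree hφ, CSTriangulation.potential_ofTree hφ,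
    Weight.sum_zigzag_zero hk hS, Weight.sum_zagzig_zero hk hS, abs_le] at this
  linarith [this.1]

end Cyclohedron

theorem theorem1p2 (d : ℕ) (hd : 5 < d) :
    ∃ T₁ T₂ : Cyclohedron.CSTriangulation d,
      5 * (d : ℝ) / 2 - 4 * Real.sqrt (d : ℝ) - 4 ≤
        ((Cyclohedron.flipGraph d).dist T₁ T₂ : ℝ) := by
  have hd' : (6 : ℝ) ≤ d := by exact_mod_cast hd
  have hsq := Real.sq_sqrt (show (0 : ℝ) ≤ d by linarith)
  -- As `2.4 ^ 2 < 6`, this holds for `d ≥ 6`. The value exceeds the positive root of `x ^ 2 = x +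
  -- 3`, which gives `2 * k + 1 < √d + 3 < d` below.
  have hσ : 2.4 ≤ √(d : ℝ) := Real.le_sqrt_of_sq_le (by norm_num; linarith)
  obtain ⟨k, hk⟩ : ∃ k, k = ⌈√(d : ℝ) / 2⌉₊ := ⟨_, rfl⟩
  have hk1 : √(d : ℝ) / 2 ≤ k := hk ▸ Nat.le_ceil _
  have hk2 : (k : ℝ) < √(d : ℝ) / 2 + 1 := hk ▸ Nat.ceil_lt_add_one (by positivity)
  have hk0 : 1 < k := by
    have : (1 : ℝ) < k := by linarith
    exact_mod_cast this
  have hk3 : (k : ℝ) ≤ √(d : ℝ) := by linarith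
  generalize √(d : ℝ) = σ at *
  have hkR : (0 : ℝ) < k := by linarith
  -- Expanded with `σ ^ 2 = d` and divided by `k`, this reads `3 * k + d / k ≤ 4 * σ`: the loss in
  -- the bound is at most `4 * √d`.
  have key : 0 ≤ (3 * (k : ℝ) - σ) * (σ - k) := mul_nonneg (by linarith) (by linarith)
  have hkd : (2 : ℝ) * k + 1 < d := by nlinarith
  have hkd' : 2 * k + 1 < d := by exact_mod_cast hkd
  rcases Nat.even_or_odd' d with ⟨e, he | he⟩
  -- The fan has the least size `s ≥ 2 * k` with the parity of `d`, and the zigzag takes the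
  -- remaining vertices.
  · obtain ⟨m, rfl⟩ : ∃ m, e = k + 1 + m := Nat.exists_eq_add_of_le (by omega)
    obtain ⟨T, T', h⟩ := Cyclohedron.exists_dist_ge (d := d) (k := k) (s := 2 * k) (m := m)
      (by omega) (by push_cast; omega) (by omega)
    refine ⟨T, T', le_of_mul_le_mul_left ?_ hkR⟩
    have h' : ((m : ℝ) + 1) * (5 * k - 2) + (2 * k - 2) * (k - 1) ≤
        k * (Cyclohedron.flipGraph d).dist T T' := by exact_mod_cast h
    refine le_trans ?_ h'
    have : (d : ℝ) = 2 * (k + 1 + m) := by rw [he]; push_cast; ring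
    have hm : (m : ℝ) = d / 2 - k - 1 := by linarith
    rw [hm]
    nlinarith
  · obtain ⟨m, rfl⟩ : ∃ m, e = k + 1 + m := Nat.exists_eq_add_of_le (by omega)
    obtain ⟨T, T', h⟩ := Cyclohedron.exists_dist_ge (d := d) (k := k) (s := 2 * k + 1) (m := m)
      (by omega) (by push_cast; omega) (by omega)
    refine ⟨T, T', le_of_mul_le_mul_left ?_ hkR⟩
    have h' : ((m : ℝ) + 1) * (5 * k - 2) + (2 * k + 1 - 2) * (k - 1) ≤
        k * (Cyclohedron.flipGraph d).dist T T' := by exact_mod_cast h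
    refine le_trans ?_ h'
    have : (d : ℝ) = 2 * (k + 1 + m) + 1 := by rw [he]; push_cast; ring
    have hm : (m : ℝ) = (d - 1) / 2 - k - 1 := by linarith
    rw [hm]
    nlinarith
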